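/- **Theorem (Variance Growth of the Rank).** Let $0\le d'<d$, let $L>0$, $a\in\mathbb R^d$ and $\sigma\in\{-1,0,1\}^d$ with exactly $d'$ zero entries, and let $Y=\prod_i[a_i,a_i+L]$ (source) and $X=Y+L\sigma$ (target), two neighbouring hypercubes that share a $d'$-dimensional face. *Kernel.* Let $\mathbb K\in\{\mathbb R,\mathbb C\}$ and let $\mathcal K:\operatorname{int}X\times\operatorname{int}Y\to\mathbb K$ be a measurable kernel which is far-field analytic in the following sense: there are constants $\rho>1$, $C$ and $D\in\mathbb N$ such that for every $x\in\operatorname{int}X$ and every cube $Q=\prod_i[c_i,c_i+s]\subseteq Y$, $s>0$, that is at least one cube away from $X$ (that is, $\|u-y\|_\infty\ge s$ for all $u\in X$, $y\in Q$), one has $\mathcal K(x,y)=P(y)F(y)$ for $y\in\operatorname{int}Q$, where $P$ is a polynomial of degree at most $D$ and $F$ is analytic on the generalized Bernstein ellipse $B(Q,\rho)=\{z\in\mathbb C^d: |z_i-c_i|+|z_i-c_i-s|<\tfrac s2(\rho+\rho^{-1})\ \forall i\}$ with $|F(z)|\le C\,|F(y)|$ for all $z\in B(Q,\rho)$, $y\in\operatorname{int}Q$.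 (With $P=1$ this says that $\mathcal K(x,\cdot)$ itself extends analytically, with modulus controlled by its size on $Q$; the factor $P$ allows zeros of the kernel.) *Subdivision.* For each $n$ put $\kappa=\lfloor\log_{2^d}n\rfloor$. Divide $Y$ into $2^d$ equal cubes; at each further level divide again into $2^d$ equal cubes those cubes that share a $d'$-dimensional face with $X$, up to level $\kappa$. Let $Y_{k,l}$, $1\le l\le h_k$, be the cubes of level $k\in\{1,\dots,\kappa\}$ obtained in this way that do not share a $d'$-dimensional face with $X$, and let $Y_\kappa$ be the union of the cubes of level $\kappa$ that do (with $Y_0=Y$). *Random rank.* For each $n$ let $x_1,\dots,x_n$ be i.i.d. uniform on $X$ and $y_1,\dots,y_n$ i.i.d. uniform on $Y$. Let $N_{k,l}$ and $M_\kappa$ be the numbers of the points $y_j$ in $Y_{k,l}$ and in $Y_\kappa$, and for $p\in\mathbb N$ put $$\mathcal R=\sum_{k=1}^{\kappa}\sum_{l=1}^{h_k}\min\{N_{k,l},p\}+M_\kappa .$$ Let $K=(\mathcal K(x_i,y_j))_{i,j\le n}$ be the random kernel matrix, let $K_{k,l}$ and $K_\kappa$ be obtained from $K$ by replacing with zero the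 columns of the particles outside $Y_{k,l}$ and outside $Y_\kappa$, respectively, and let $\|A\|_{\infty^*}=\max_{i,j}|A_{ij}|$. Then for every $\delta>0$ there is $p\in\mathbb N$, depending only on $\delta$, $\mathcal K$, $X$, $Y$ (not on $n$), such that for every $n$ there are random matrices $\tilde K_{k,l}$ and $\tilde K_\kappa$ for which, with $\tilde K=\sum_{k=1}^\kappa\sum_{l=1}^{h_k}\tilde K_{k,l}+\tilde K_\kappa$, almost surely $$\operatorname{rank}\tilde K_{k,l}\le\min\{N_{k,l},p\},\qquad \operatorname{rank}\tilde K_\kappa\le M_\kappa,\qquad \operatorname{rank}\tilde K\le\mathcal R,$$ and, whenever $K\ne0$, $$\frac{\|K-\tilde K\|_{\infty^*}}{\|K\|_{\infty^*}}<\delta,\qquad \frac{\|K_{k,l}-\tilde K_{k,l}\|_{\infty^*}}{\|K\|_{\infty^*}}<\delta,\qquad \frac{\|K_\kappa-\tilde K_\kappa\|_{\infty^*}}{\|K\|_{\infty^*}}<\delta ;$$ and, as $n\to\infty$, 1. if $d'=0$ (vertex-sharing interaction), then $\operatorname{Var}(\mathcal R)\in\mathcal O\big((\log\log\log n)^2\big)$;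 2. if $d'\ge1$, then $\operatorname{Var}(\mathcal R)\in\mathcal O\big((n^{d'/d}\log\log\log n)^2\big)$. -/

import Mathlib

open MeasureTheory ProbabilityTheory Filter Asymptotics

/-! ### Geometry of the source and target cubes -/

/-- The closed axis-parallel hypercube `∏ᵢ [cᵢ, cᵢ + s]`. -/
def hypercube {d : ℕ} (c : Fin d → ℝ) (s : ℝ) : Set (Fin d → ℝ) :=
  Set.Icc c (fun i => c i + s)

/-- The source domain is `Y = hypercube a L`; the target domain is its neighbour
`X = hypercube (targetCorner a L σ) L`, the translate of `Y` by `σᵢ L ∈ {-L, 0, L}` in the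
`i`-th coordinate. The two cubes share a face whose dimension is the number of `i` with
`σ i = 0`. -/
def targetCorner {d : ℕ} (a : Fin d → ℝ) (L : ℝ) (σ : Fin d → SignType) : Fin d → ℝ :=
  fun i => a i + (σ i : ℝ) * L

/-! ### The hierarchical subdivision of the source cube -/

/-- The cell with index `m` (with `0 ≤ mᵢ < 2ᵏ`) of the subdivision of the source cube into
`2^(d k)` congruent cubes of side `L / 2ᵏ`. Cells are half-open, so that those of one level are
disjoint; their boundaries are null sets for the uniform distribution. -/
def cell {d : ℕ} (a : Fin d → ℝ) (L : ℝ) (k : ℕ) (m : Fin d → ℕ) : Set (Fin d → ℝ) :=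
  {y | ∀ i, a i + L * (m i : ℝ) / 2 ^ k ≤ y i ∧ y i < a i + L * ((m i : ℝ) + 1) / 2 ^ k}

/-- The level-`k` cell `m` shares with `X` a face of the same dimension as the face shared by
`X` and `Y`: in each direction in which `X` is displaced, it is the outermost cell on the side
of `X`. -/
def TouchesTarget {d : ℕ} (σ : Fin d → SignType) (k : ℕ) (m : Fin d → ℕ) : Prop :=
  ∀ i, (σ i = 1 → m i + 1 = 2 ^ k) ∧ (σ i = -1 → m i = 0)

instance {d : ℕ} (σ : Fin d → SignType) (k : ℕ) :
    DecidablePred (TouchesTarget σ k) := fun m => by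
  unfold TouchesTarget; infer_instance

/-- All cell indices of level `k`. -/
def cellIndices (d k : ℕ) : Finset (Fin d → ℕ) :=
  Fintype.piFinset fun _ => Finset.range (2 ^ k)

/-- Indices of the cells `Y_{k,l}`, `l = 1, …, h_k` (for `k ≥ 1`): the children, under halving of
the sides, of touching cells of level `k - 1` that do not touch themselves. The parent of the
cell `m` is `⌊m / 2⌋`. -/
def farIndices {d : ℕ} (σ : Fin d → SignType) (k : ℕ) : Finset (Fin d → ℕ) :=
  (cellIndices d k).filter fun m =>
    TouchesTarget σ (k - 1) (fun i => m i / 2) ∧ ¬ TouchesTarget σ k m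

/-- `Y_k`, the union of the touching cells of level `k`. -/
def nearRegion {d : ℕ} (a : Fin d → ℝ) (L : ℝ) (σ : Fin d → SignType) (k : ℕ) :
    Set (Fin d → ℝ) :=
  ⋃ m ∈ (cellIndices d k).filter (TouchesTarget σ k), cell a L k m

/-- The depth `κ = ⌊log_{2^d} n⌋` of the subdivision. -/
def depth (d n : ℕ) : ℕ := Nat.log (2 ^ d) n

/-! ### The random rank -/

open Classical in
/-- The number of particles of the configuration `y` that lie in `V`. -/
noncomputable def particleCount {d n : ℕ} (y : Fin n → Fin d → ℝ) (V : Set (Fin d → ℝ)) : ℕ :=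
  (Finset.univ.filter fun j => y j ∈ V).card

/-- `R = ∑_{k=1}^κ ∑_l min (N_{k,l}, p) + M_κ`, where `N_{k,l}` and `M_κ` are the numbers of
source particles in `Y_{k,l}` and `Y_κ`. -/
noncomputable def rankR {d n : ℕ} (a : Fin d → ℝ) (L : ℝ) (σ : Fin d → SignType) (p : ℕ)
    (y : Fin n → Fin d → ℝ) : ℕ :=
  (∑ k ∈ Finset.Icc 1 (depth d n), ∑ m ∈ farIndices σ k,
    min (particleCount y (cell a L k m)) p) + particleCount y (nearRegion a L σ (depth d n))

/-! ### Kernel matrices -/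

/-- The max-norm `max_{i,j} |A_{ij}|` (zero for the empty matrix). -/
noncomputable def maxNorm {𝕜 : Type*} [RCLike 𝕜] {n : ℕ} (A : Matrix (Fin n) (Fin n) 𝕜) : ℝ :=
  ⨆ q : Fin n × Fin n, ‖A q.1 q.2‖

/-- The kernel matrix `K_{ij} = K(x_i, y_j)`. -/
def kernelMatrix {𝕜 : Type*} {d n : ℕ} (K : (Fin d → ℝ) → (Fin d → ℝ) → 𝕜)
    (x y : Fin n → Fin d → ℝ) : Matrix (Fin n) (Fin n) 𝕜 :=
  Matrix.of fun i j => K (x i) (y j)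

open Classical in
/-- The part of the kernel matrix that belongs to the interaction of `X` with `V ⊆ Y`: the
columns of source particles outside `V` are replaced by zero. -/
noncomputable def blockMatrix {𝕜 : Type*} [RCLike 𝕜] {d n : ℕ}
    (K : (Fin d → ℝ) → (Fin d → ℝ) → 𝕜) (x y : Fin n → Fin d → ℝ) (V : Set (Fin d → ℝ)) :
    Matrix (Fin n) (Fin n) 𝕜 :=
  Matrix.of fun i j => if y j ∈ V then K (x i) (y j) else 0

/-- The sum `K̃ = ∑_{k=1}^κ ∑_l K̃_{k,l} + K̃_κ`. -/
def assemble {𝕜 : Type*} [RCLike 𝕜] {d n : ℕ} (σ : Fin d → SignType)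
    (Kfar : ℕ → (Fin d → ℕ) → Matrix (Fin n) (Fin n) 𝕜) (Knear : Matrix (Fin n) (Fin n) 𝕜) :
    Matrix (Fin n) (Fin n) 𝕜 :=
  (∑ k ∈ Finset.Icc 1 (depth d n), ∑ m ∈ farIndices σ k, Kfar k m) + Knear

/-- For one configuration of particles, `Kfar k m` and `Knear` are `δ`-accurate approximations of
the blocks of the kernel matrix, of rank at most `min (N_{k,l}, p)` and `M_κ`, whose sum is a
`δ`-accurate approximation of the kernel matrix, of rank at most `R`. (A relative error makes
sense only if the kernel matrix is nonzero.) -/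
structure IsHierarchicalApprox {𝕜 : Type*} [RCLike 𝕜] {d n : ℕ}
    (K : (Fin d → ℝ) → (Fin d → ℝ) → 𝕜) (a : Fin d → ℝ) (L : ℝ) (σ : Fin d → SignType)
    (δ : ℝ) (p : ℕ) (x y : Fin n → Fin d → ℝ)
    (Kfar : ℕ → (Fin d → ℕ) → Matrix (Fin n) (Fin n) 𝕜)
    (Knear : Matrix (Fin n) (Fin n) 𝕜) : Prop where
  far_rank : ∀ k ∈ Finset.Icc 1 (depth d n), ∀ m ∈ farIndices σ k,
    (Kfar k m).rank ≤ min (particleCount y (cell a L k m)) p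
  near_rank : Knear.rank ≤ particleCount y (nearRegion a L σ (depth d n))
  total_rank : (assemble σ Kfar Knear).rank ≤ rankR a L σ p y
  far_error : kernelMatrix K x y ≠ 0 →
    ∀ k ∈ Finset.Icc 1 (depth d n), ∀ m ∈ farIndices σ k,
      maxNorm (blockMatrix K x y (cell a L k m) - Kfar k m) / maxNorm (kernelMatrix K x y) < δ
  near_error : kernelMatrix K x y ≠ 0 →
    maxNorm (blockMatrix K x y (nearRegion a L σ (depth d n)) - Knear)
      / maxNorm (kernelMatrix K x y) < δ
  total_error : kernelMatrix K x y ≠ 0 →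
    maxNorm (kernelMatrix K x y - assemble σ Kfar Knear) / maxNorm (kernelMatrix K x y) < δ

/-! ### Admissible kernels -/

/-- The (open, filled) generalized Bernstein ellipse of the cube `∏ᵢ [cᵢ, cᵢ + s]` with parameter
`ρ > 1`: the product of the ellipses in `ℂ` with foci `cᵢ` and `cᵢ + s` whose semi-axes add up
to `ρ s / 2`. -/
def bernsteinEllipse {d : ℕ} (c : Fin d → ℝ) (s ρ : ℝ) : Set (Fin d → ℂ) :=
  {z | ∀ i, ‖z i - (c i : ℂ)‖ + ‖z i - ((c i + s : ℝ) : ℂ)‖ < s / 2 * (ρ + ρ⁻¹)}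

/-- A real point, seen as a point of `ℂ^d`. -/
def toComplexPoint {d : ℕ} (y : Fin d → ℝ) : Fin d → ℂ := fun i => (y i : ℂ)

/-- The kernel `K` is far-field analytic on `int X × int Y`: there are `ρ > 1`, `C` and `D` such
that for every target point `x` and every cube `Q ⊆ Y` which is at least one cube of its own size
away from `X`, the function `K(x, ·)` is on `int Q` the product of a polynomial of degree at most
`D` (which may carry the zeros of the kernel) and a function `F` that extends analytically to the
generalized Bernstein ellipse of `Q`, where its modulus is at most `C` times its smallest modulus
on `int Q`. -/
def FarFieldAnalytic {𝕜 : Type*} [RCLike 𝕜] {d : ℕ} (K : (Fin d → ℝ) → (Fin d → ℝ) → 𝕜)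
    (X Y : Set (Fin d → ℝ)) : Prop :=
  ∃ (ρ C : ℝ) (D : ℕ), 1 < ρ ∧
    ∀ x ∈ interior X, ∀ (c : Fin d → ℝ) (s : ℝ), 0 < s → hypercube c s ⊆ Y →
      (∀ u ∈ X, ∀ y ∈ hypercube c s, s ≤ dist u y) →
      ∃ (P : MvPolynomial (Fin d) ℂ) (F : (Fin d → ℂ) → ℂ),
        P.totalDegree ≤ D ∧
        AnalyticOnNhd ℂ F (bernsteinEllipse c s ρ) ∧
        (∀ y ∈ interior (hypercube c s),
          RCLike.map 𝕜 ℂ (K x y) =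
            MvPolynomial.eval (toComplexPoint y) P * F (toComplexPoint y)) ∧
        ∀ z ∈ bernsteinEllipse c s ρ, ∀ y ∈ interior (hypercube c s),
          ‖F z‖ ≤ C * ‖F (toComplexPoint y)‖

/-! ### Combinatorics of the subdivision -/

/-! Accuracy. On a far cell the analytic factor `F` of the kernel is bounded, in a complex
neighbourhood whose width is proportional to the side of the cell, by a multiple of its modulus at
any interior point of the cell. The Schwarz lemma therefore makes its relative oscillation small on
subcells of relative level `t`, with `t` independent of the cell, its scale and the target point.
Freezing `F` at the subcell centres and keeping the polynomial factor exactly gives a combination of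
`p` fixed functions of `y` with coefficients depending on `x` (`exists_far_approx`): a block of rank
at most `p` with small relative error entry by entry, even where the kernel vanishes. Each column
belongs to a single cell, so errors do not accumulate over cells; the near block is kept unchanged.
`exists_measurable_coeff` makes the coefficients random variables.

Variance. The counts in different cells are dependent, but standard deviations add up at worst
(`variance_sum_le_sq`). A far cell of level `k` has mean count at least `2 ^ (d * (κ - k))`, and a
count with large mean, truncated at `p`, is nearly the constant `p`
(`variance_min_particleCount_le`). So the deviation per cell decays geometrically in `κ - k`, while
a level has at most `2 ^ d * 2 ^ (d' * κ)` far cells. The levels together contribute a multiple of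
`2 ^ (d' * κ) ≤ n ^ (d' / d)`, and the near count has variance of order `2 ^ (d' * κ)`. The
resulting bound is a multiple of `(n ^ (d' / d)) ^ 2`; the triple logarithm, eventually at least
`1`, only weakens it. -/

/-- The index of the level-`k` cell that contains `y`. -/
noncomputable def cellIndex {d : ℕ} (a : Fin d → ℝ) (L : ℝ) (k : ℕ) (y : Fin d → ℝ) : Fin d → ℕ :=
  fun i => ⌊(y i - a i) * 2 ^ k / L⌋₊

/-- The lower bound on `y` is needed because the natural floor sends negative numbers to `0`. -/
lemma mem_cell_iff {d : ℕ} {a : Fin d → ℝ} {L : ℝ} (hL : 0 < L) {y : Fin d → ℝ}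
    (hy : ∀ i, a i ≤ y i) (k : ℕ) (m : Fin d → ℕ) :
    y ∈ cell a L k m ↔ cellIndex a L k y = m := by
  simp only [cell, Set.mem_ofPred_eq, funext_iff, cellIndex]
  refine forall_congr' fun i => ?_
  have h0 : 0 ≤ (y i - a i) * 2 ^ k / L :=
    div_nonneg (mul_nonneg (sub_nonneg.2 (hy i)) (by positivity)) hL.le
  rw [Nat.floor_eq_iff h0, le_div_iff₀ hL, div_lt_iff₀ hL]
  have h2 : (0 : ℝ) < 2 ^ k := by positivity
  rw [← le_sub_iff_add_le', ← sub_lt_iff_lt_add', div_le_iff₀ h2, lt_div_iff₀ h2,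
    mul_comm L, mul_comm L]

lemma le_of_mem_cell {d : ℕ} {a : Fin d → ℝ} {L : ℝ} (hL : 0 < L) {y : Fin d → ℝ} {k : ℕ}
    {m : Fin d → ℕ} (h : y ∈ cell a L k m) (i : Fin d) : a i ≤ y i :=
  le_trans (le_add_of_nonneg_right (by positivity)) (h i).1

lemma cellIndex_div_two {d : ℕ} (a : Fin d → ℝ) (L : ℝ) (k : ℕ) (y : Fin d → ℝ) :
    (fun i => cellIndex a L (k + 1) y i / 2) = cellIndex a L k y := by
  funext i
  rw [cellIndex, cellIndex, ← Nat.floor_div_ofNat]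
  congr 1
  rw [pow_succ]
  ring

lemma cellIndex_mem_cellIndices {d : ℕ} {a : Fin d → ℝ} {L : ℝ} (hL : 0 < L) {y : Fin d → ℝ}
    (hy : y ∈ cell a L 0 0) (k : ℕ) : cellIndex a L k y ∈ cellIndices d k := by
  simp only [cellIndices, Fintype.mem_piFinset, Finset.mem_range]
  intro i
  have h1 := hy i
  simp only [Pi.zero_apply, Nat.cast_zero, mul_zero, pow_zero, div_one, add_zero, zero_add,
    mul_one] at h1
  rw [cellIndex, Nat.floor_lt (div_nonneg (mul_nonneg (by linarith [h1.1]) (by positivity)) hL.le),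
    div_lt_iff₀ hL]
  push_cast
  rw [mul_comm]
  have h2 : (0 : ℝ) < 2 ^ k := by positivity
  exact mul_lt_mul_of_pos_left (by linarith [h1.2]) h2

lemma mem_nearRegion_iff {d : ℕ} {a : Fin d → ℝ} {L : ℝ} (hL : 0 < L) (σ : Fin d → SignType)
    {y : Fin d → ℝ} (hy : y ∈ cell a L 0 0) (k : ℕ) :
    y ∈ nearRegion a L σ k ↔ TouchesTarget σ k (cellIndex a L k y) := by
  simp only [nearRegion, Set.mem_iUnion, Finset.mem_filter, exists_prop,
    mem_cell_iff hL (le_of_mem_cell hL hy)]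
  constructor
  · rintro ⟨m, ⟨-, hm⟩, rfl⟩
    exact hm
  · exact fun h => ⟨_, ⟨cellIndex_mem_cellIndices hL hy k, h⟩, rfl⟩

/-- Near regions are nested, so each one splits into the next near region and the far cells of the
next level. -/
lemma touchesTarget_div_two {d : ℕ} {σ : Fin d → SignType} {k : ℕ} {m : Fin d → ℕ}
    (h : TouchesTarget σ (k + 1) m) : TouchesTarget σ k (fun i => m i / 2) := by
  intro i
  obtain ⟨h1, h2⟩ := h i
  refine ⟨fun hi => ?_, fun hi => ?_⟩
  · have := h1 hi
    rw [pow_succ] at this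
    change m i / 2 + 1 = 2 ^ k
    omega
  · simp [h2 hi]

open Classical in
lemma sum_farIndices_add_nearRegion_succ {d : ℕ} {a : Fin d → ℝ} {L : ℝ} (hL : 0 < L)
    (σ : Fin d → SignType) {y : Fin d → ℝ} (hy : y ∈ cell a L 0 0) {M : Type*} [AddCommMonoid M]
    (v : M) (k : ℕ) :
    (∑ m ∈ farIndices σ (k + 1), if y ∈ cell a L (k + 1) m then v else 0) +
      (if y ∈ nearRegion a L σ (k + 1) then v else 0) =
    if y ∈ nearRegion a L σ k then v else 0 := by
  simp only [mem_nearRegion_iff hL σ hy, mem_cell_iff hL (le_of_mem_cell hL hy)]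
  rw [Finset.sum_ite_eq]
  have hm := cellIndex_mem_cellIndices hL hy (k + 1)
  have hdiv := cellIndex_div_two a L k y
  simp only [farIndices, Finset.mem_filter, hm, true_and, Nat.add_sub_cancel, hdiv]
  have himp := @touchesTarget_div_two d σ k (cellIndex a L (k + 1) y)
  rw [hdiv] at himp
  by_cases h1 : TouchesTarget σ (k + 1) (cellIndex a L (k + 1) y)
  · simp [h1, himp h1]
  · simp [h1]

open Classical in
/-- A point of the half-open source cube lies in exactly one far cell or in the near region. -/
lemma sum_far_add_near {d : ℕ} {a : Fin d → ℝ} {L : ℝ} (hL : 0 < L)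
    (σ : Fin d → SignType) {y : Fin d → ℝ} (hy : y ∈ cell a L 0 0) {M : Type*} [AddCommMonoid M]
    (v : M) (κ : ℕ) :
    (∑ k ∈ Finset.Icc 1 κ, ∑ m ∈ farIndices σ k, if y ∈ cell a L k m then v else 0) +
      (if y ∈ nearRegion a L σ κ then v else 0) = v := by
  induction κ with
  | zero =>
    have : y ∈ nearRegion a L σ 0 := by
      rw [mem_nearRegion_iff hL σ hy]
      have := cellIndex_mem_cellIndices hL hy 0
      simp only [cellIndices, pow_zero, Finset.range_one, Fintype.mem_piFinset,
        Finset.mem_singleton] at this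
      intro i
      simp [this i]
    simp [this]
  | succ κ ih =>
    rw [Finset.sum_Icc_succ_top (by omega), add_assoc,
      sum_farIndices_add_nearRegion_succ hL σ hy, ih]

/-- Only the coordinates along the shared face are free; each displaced coordinate is forced to its
extreme value. -/
lemma card_touching_le {d : ℕ} (σ : Fin d → SignType) (k : ℕ) :
    ((cellIndices d k).filter (TouchesTarget σ k)).card ≤
      2 ^ ((Finset.univ.filter fun i => σ i = 0).card * k) := by
  have hsub : (cellIndices d k).filter (TouchesTarget σ k) ⊆ Fintype.piFinset fun i =>
      if σ i = 0 then Finset.range (2 ^ k) else if σ i = 1 then {2 ^ k - 1} else {0} := by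
    intro m hm
    simp only [Finset.mem_filter, cellIndices, Fintype.mem_piFinset] at hm ⊢
    intro i
    obtain ⟨h1, h2⟩ := hm.2 i
    have h3 := hm.1 i
    rcases hs : σ i with _ | _ | _
    · simpa using h3
    · simpa using h2 hs
    · have := h1 hs
      simp only [SignType.pos_eq_one, one_ne_zero, if_false, if_true, Finset.mem_singleton]
      omega
  refine (Finset.card_le_card hsub).trans ?_
  rw [Fintype.card_piFinset]
  calc _ ≤ ∏ i, (if σ i = 0 then 2 ^ k else 1) := by
        refine Finset.prod_le_prod' fun i _ => ?_
        split_ifs <;> simp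
    _ = _ := by
        rw [Finset.prod_ite]
        simp [← pow_mul, mul_comm]

/-- The parent touches the target, which leaves two choices per displaced coordinate. The factor `2`
is granted to every coordinate, whence `2 ^ d`. -/
lemma card_farIndices_le {d : ℕ} (σ : Fin d → SignType) (k : ℕ) :
    (farIndices σ k).card ≤
      2 ^ d * 2 ^ ((Finset.univ.filter fun i => σ i = 0).card * k) := by
  have hsub : farIndices σ k ⊆ Fintype.piFinset fun i =>
      if σ i = 0 then Finset.range (2 ^ k) else
        if σ i = 1 then {2 * (2 ^ (k - 1) - 1), 2 * (2 ^ (k - 1) - 1) + 1} else {0, 1} := by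
    intro m hm
    simp only [farIndices, Finset.mem_filter, cellIndices, Fintype.mem_piFinset] at hm ⊢
    intro i
    obtain ⟨h1, h2⟩ := hm.2.1 i
    have h3 := hm.1 i
    rcases hs : σ i with _ | _ | _
    · simpa using h3
    · have h4 : m i / 2 = 0 := h2 hs
      simp [SignType.neg_eq_neg_one]
      omega
    · have h4 : m i / 2 + 1 = 2 ^ (k - 1) := h1 hs
      simp only [SignType.pos_eq_one, one_ne_zero, if_false, if_true, Finset.mem_singleton,
        Finset.mem_insert]
      omega
  refine (Finset.card_le_card hsub).trans ?_
  rw [Fintype.card_piFinset]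
  calc _ ≤ ∏ i, 2 * (if σ i = 0 then 2 ^ k else 1) := by
        refine Finset.prod_le_prod' fun i _ => ?_
        split_ifs
        · simp
        · exact Finset.card_le_two
        · exact Finset.card_le_two
    _ = _ := by
        rw [Finset.prod_mul_distrib, Finset.prod_ite]
        simp [← pow_mul, mul_comm]

/-! ### Position of the cells relative to the target cube -/

/-- The lower corner of the level-`k` cell `m`. -/
noncomputable def cellCorner {d : ℕ} (a : Fin d → ℝ) (L : ℝ) (k : ℕ) (m : Fin d → ℕ) :
    Fin d → ℝ := fun i => a i + L * m i / 2 ^ k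

lemma interior_hypercube {d : ℕ} (c : Fin d → ℝ) (s : ℝ) :
    interior (hypercube c s) = {y | ∀ i, c i < y i ∧ y i < c i + s} := by
  rw [hypercube, ← Set.pi_univ_Icc, interior_pi_set Set.finite_univ]
  ext y
  simp [interior_Icc]

lemma hypercube_cellCorner_subset {d : ℕ} {a : Fin d → ℝ} {L : ℝ} (hL : 0 < L) {k : ℕ}
    {m : Fin d → ℕ} (hm : m ∈ cellIndices d k) :
    hypercube (cellCorner a L k m) (L / 2 ^ k) ⊆ hypercube a L := by
  simp only [cellIndices, Fintype.mem_piFinset, Finset.mem_range] at hm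
  refine Set.Icc_subset_Icc (fun i => ?_) (fun i => ?_)
  · exact le_add_of_nonneg_right (by positivity)
  · have h1 : ((m i : ℝ) + 1) ≤ 2 ^ k := by exact_mod_cast hm i
    have h2 : (0 : ℝ) < 2 ^ k := by positivity
    simp only [cellCorner]
    rw [add_assoc, ← add_div]
    gcongr
    rw [div_le_iff₀ h2]
    nlinarith

/-- In some displaced coordinate the cell is not outermost, so a full cell width separates it from
the target there, and the sup distance dominates that coordinate. -/
lemma le_dist_of_not_touchesTarget {d : ℕ} {a : Fin d → ℝ} {L : ℝ} (hL : 0 < L)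
    {σ : Fin d → SignType} {k : ℕ} {m : Fin d → ℕ} (hm : m ∈ cellIndices d k)
    (hT : ¬ TouchesTarget σ k m) {u y : Fin d → ℝ} (hu : u ∈ hypercube (targetCorner a L σ) L)
    (hy : y ∈ hypercube (cellCorner a L k m) (L / 2 ^ k)) : L / 2 ^ k ≤ dist u y := by
  simp only [cellIndices, Fintype.mem_piFinset, Finset.mem_range] at hm
  simp only [TouchesTarget, not_forall] at hT
  obtain ⟨i, hi⟩ := hT
  refine le_trans ?_ (dist_le_pi_dist u y i)
  have hu1 := hu.1 i
  have hu2 := hu.2 i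
  have hy1 := hy.1 i
  have hy2 := hy.2 i
  simp only [cellCorner, targetCorner] at hu1 hu2 hy1 hy2
  have h2 : (0 : ℝ) < 2 ^ k := by positivity
  rw [Real.dist_eq]
  rcases hs : σ i with _ | _ | _
  · simp [hs] at hi
  · have h0 : m i ≠ 0 := by
      intro h0
      simp [hs, h0] at hi
    have h1 : (1 : ℝ) ≤ m i := by exact_mod_cast Nat.one_le_iff_ne_zero.2 h0
    simp [hs] at hu1 hu2
    have h3 : L / 2 ^ k ≤ L * m i / 2 ^ k := by gcongr; nlinarith
    rw [abs_sub_comm]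
    exact le_trans (by linarith) (le_abs_self _)
  · have h0 : m i + 1 ≠ 2 ^ k := by
      intro h0
      simp [hs, h0] at hi
    have h1 : (m i : ℝ) + 2 ≤ 2 ^ k := by exact_mod_cast (by have := hm i; omega : m i + 2 ≤ 2 ^ k)
    simp [hs] at hu1 hu2
    have h3 : L * m i / 2 ^ k + L / 2 ^ k + L / 2 ^ k ≤ L := by
      rw [← add_div, ← add_div, div_le_iff₀ h2]
      nlinarith
    exact le_trans (by linarith) (le_abs_self _)

/-! ### Comparison of the scalar fields -/

/-- The map is an inclusion, an isometry or the real part. It serves to carry estimates obtained in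
`ℂ` back to `𝕜`. -/
lemma rclike_norm_map_le {𝕜 𝕜' : Type*} [RCLike 𝕜] [RCLike 𝕜'] (z : 𝕜) :
    ‖RCLike.map 𝕜 𝕜' z‖ ≤ ‖z‖ := by
  rw [← sq_le_sq₀ (norm_nonneg _) (norm_nonneg _), RCLike.norm_sq_eq_def, RCLike.norm_sq_eq_def]
  have hI : RCLike.im (RCLike.I : 𝕜') ^ 2 ≤ 1 := by
    rcases RCLike.I_eq_zero_or_im_I_eq_one (K := 𝕜') with h | h <;> simp [h]
  have h1 : RCLike.re (RCLike.map 𝕜 𝕜' z) = RCLike.re z := by simp [RCLike.map]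
  have h2 : RCLike.im (RCLike.map 𝕜 𝕜' z) = RCLike.im z * RCLike.im (RCLike.I : 𝕜') := by
    simp [RCLike.map]
  rw [h1, h2]
  nlinarith [mul_nonneg (sq_nonneg (RCLike.im z)) (sub_nonneg.2 hI)]

lemma rclike_map_map_complex {𝕜 : Type*} [RCLike 𝕜] (z : 𝕜) :
    RCLike.map ℂ 𝕜 (RCLike.map 𝕜 ℂ z) = z := by
  simp [RCLike.map]

lemma rclike_map_mul_ofReal {𝕜 𝕜' : Type*} [RCLike 𝕜] [RCLike 𝕜'] (z : 𝕜) (r : ℝ) :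
    RCLike.map 𝕜 𝕜' (z * (r : 𝕜)) = RCLike.map 𝕜 𝕜' z * (r : 𝕜') := by
  rw [mul_comm, ← RCLike.real_smul_eq_coe_mul, map_smul, RCLike.real_smul_eq_coe_mul, mul_comm]

/-! ### Oscillation of analytic functions on a cube -/

/-- For a real point of the cube the two focal distances add up to `s` in each coordinate; moving by
less than `r` adds less than `2 * r`. -/
lemma ball_subset_bernsteinEllipse {d : ℕ} {c : Fin d → ℝ} {s ρ r : ℝ}
    (hr : s + 2 * r ≤ s / 2 * (ρ + ρ⁻¹)) {y : Fin d → ℝ} (hy : y ∈ hypercube c s) :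
    Metric.ball (toComplexPoint y) r ⊆ bernsteinEllipse c s ρ := by
  intro z hz i
  have h0 : ‖z i - (y i : ℂ)‖ < r := by
    rw [← Complex.dist_eq]
    exact (dist_le_pi_dist z (toComplexPoint y) i).trans_lt hz
  have h1 : ‖(y i : ℂ) - (c i : ℂ)‖ = y i - c i := by
    rw [← Complex.ofReal_sub, Complex.norm_real, Real.norm_eq_abs,
      abs_of_nonneg (sub_nonneg.2 (hy.1 i))]
  have h2 : ‖(y i : ℂ) - ((c i + s : ℝ) : ℂ)‖ = c i + s - y i := by
    rw [← Complex.ofReal_sub, Complex.norm_real, Real.norm_eq_abs,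
      abs_of_nonpos (sub_nonpos.2 (hy.2 i))]
    ring
  have h3 := norm_sub_le_norm_sub_add_norm_sub (z i) (y i : ℂ) (c i : ℂ)
  have h4 := norm_sub_le_norm_sub_add_norm_sub (z i) (y i : ℂ) ((c i + s : ℝ) : ℂ)
  linarith

lemma dist_toComplexPoint_le {d : ℕ} {y z : Fin d → ℝ} {r : ℝ} (hr : 0 ≤ r)
    (h : ∀ i, |y i - z i| ≤ r) : dist (toComplexPoint y) (toComplexPoint z) ≤ r := by
  refine (dist_pi_le_iff hr).2 fun i => ?_
  rw [toComplexPoint, toComplexPoint, Complex.dist_eq, ← Complex.ofReal_sub, Complex.norm_real]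
  exact h i

/-- A function which on the Bernstein ellipse is controlled by its size on the cube has a small
relative oscillation on small parts of the cube. -/
lemma norm_sub_le_of_bernsteinEllipse {d : ℕ} {c : Fin d → ℝ} {s ρ C h η : ℝ} (hs : 0 < s)
    (hη : 0 < η) (hηρ : 4 * η ≤ ρ + ρ⁻¹ - 2) (h0 : 0 ≤ h) (hh : h < η)
    {F : (Fin d → ℂ) → ℂ} (hF : AnalyticOnNhd ℂ F (bernsteinEllipse c s ρ))
    {y y₀ : Fin d → ℝ} (hy : y ∈ hypercube c s)
    (hC : ∀ z ∈ bernsteinEllipse c s ρ, ‖F z‖ ≤ C * ‖F (toComplexPoint y)‖)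
    (hyy : ∀ i, |y₀ i - y i| ≤ s * h) :
    ‖F (toComplexPoint y₀) - F (toComplexPoint y)‖ ≤
      (C + 1) / η * h * ‖F (toComplexPoint y)‖ := by
  have hsub : Metric.ball (toComplexPoint y) (s * η) ⊆ bernsteinEllipse c s ρ :=
    ball_subset_bernsteinEllipse (by nlinarith) hy
  have hd : dist (toComplexPoint y₀) (toComplexPoint y) ≤ s * h :=
    dist_toComplexPoint_le (by positivity) hyy
  have hmem : toComplexPoint y₀ ∈ Metric.ball (toComplexPoint y) (s * η) :=
    Metric.mem_ball.2 (hd.trans_lt (by gcongr))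
  -- On the ball, `F` deviates from its central value by at most `C + 1` times the modulus of that
  -- value; this is the input of the Schwarz lemma in `key`.
  have hmaps : Set.MapsTo F (Metric.ball (toComplexPoint y) (s * η))
      (Metric.closedBall (F (toComplexPoint y)) ((C + 1) * ‖F (toComplexPoint y)‖)) := by
    intro z hz
    rw [mem_closedBall_iff_norm]
    have h1 := hC z (hsub hz)
    have h2 := norm_sub_le (F z) (F (toComplexPoint y))
    linarith
  have key := Complex.dist_le_div_mul_dist_of_mapsTo_ball
    (hF.differentiableOn.mono hsub) hmaps hmem
  rw [dist_eq_norm] at key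
  have hnn : 0 ≤ (C + 1) * ‖F (toComplexPoint y)‖ :=
    dist_nonneg.trans (Metric.mem_closedBall.1 (hmaps hmem))
  refine key.trans ?_
  calc (C + 1) * ‖F (toComplexPoint y)‖ / (s * η) * dist (toComplexPoint y₀) (toComplexPoint y)
      ≤ (C + 1) * ‖F (toComplexPoint y)‖ / (s * η) * (s * h) := by gcongr
    _ = _ := by field_simp

/-! ### Separable approximation on a far cell -/

/-- The index set does not depend on `P`, so the same monomials serve all target points. -/
lemma eval_eq_sum_of_totalDegree_le {d D : ℕ} {P : MvPolynomial (Fin d) ℂ}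
    (hP : P.totalDegree ≤ D) (z : Fin d → ℂ) :
    MvPolynomial.eval z P = ∑ α : Fin d → Fin (D + 1),
      MvPolynomial.coeff (Finsupp.equivFunOnFinite.symm fun i => (α i : ℕ)) P *
        ∏ i, z i ^ (α i : ℕ) := by
  rw [MvPolynomial.eval_eq']
  have hle : ∀ α ∈ P.support, ∀ i, α i < D + 1 := fun α hα i =>
    Nat.lt_succ_of_le <| ((MvPolynomial.le_degreeOf_of_mem_support i hα).trans
      (MvPolynomial.degreeOf_le_totalDegree P i)).trans hP
  have hinv : ∀ α ∈ P.support, (Finsupp.equivFunOnFinite.symm fun i =>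
      ((Fin.ofNat (D + 1) (α i) : Fin (D + 1)) : ℕ)) = α := by
    intro α hα
    ext i
    simp [Nat.mod_eq_of_lt (hle α hα i)]
  refine Finset.sum_of_injOn (fun α i => Fin.ofNat (D + 1) (α i)) ?_ (fun _ _ => by simp) ?_ ?_
  · intro α hα β hβ h
    rw [← hinv α hα, ← hinv β hβ]
    congr 1
    funext i
    exact congrArg Fin.val (congrFun h i)
  · intro α _ hα
    have : (Finsupp.equivFunOnFinite.symm fun i => (α i : ℕ)) ∉ P.support := by
      refine fun hmem => hα ⟨_, hmem, ?_⟩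
      funext i
      simp
    rw [MvPolynomial.notMem_support_iff.1 this, zero_mul]
  · intro α hα
    rw [hinv α hα]
    congr 1
    refine Finset.prod_congr rfl fun i _ => ?_
    simp [Nat.mod_eq_of_lt (hle α hα i)]

/-- Index set of the functions `farBasis`. -/
abbrev FarBasisIndex (d t D : ℕ) : Type := (Fin d → Fin (2 ^ t)) × (Fin d → Fin (D + 1))

open Classical in
/-- The monomials of multidegree at most `D`, cut off to the subcells of relative level `t` of the
cell `m` of level `k`. -/
noncomputable def farBasis {d : ℕ} (a : Fin d → ℝ) (L : ℝ) (t D k : ℕ) (m : Fin d → ℕ)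
    (b : FarBasisIndex d t D) (y : Fin d → ℝ) : ℝ :=
  if y ∈ cell a L k m ∧ y ∈ cell (cellCorner a L k m) (L / 2 ^ k) t (fun i => b.1 i) then
    ∏ i, y i ^ (b.2 i : ℕ) else 0

lemma farBasis_eq_zero {d : ℕ} {a : Fin d → ℝ} {L : ℝ} {t D k : ℕ} {m : Fin d → ℕ}
    (b : FarBasisIndex d t D) {y : Fin d → ℝ} (hy : y ∉ cell a L k m) :
    farBasis a L t D k m b y = 0 := by
  simp [farBasis, hy]

lemma mem_cell_of_mem_interior {d : ℕ} {a : Fin d → ℝ} {L : ℝ} {k : ℕ} {m : Fin d → ℕ}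
    {y : Fin d → ℝ} (hy : y ∈ interior (hypercube (cellCorner a L k m) (L / 2 ^ k))) :
    y ∈ cell a L k m := by
  rw [interior_hypercube] at hy
  intro i
  refine ⟨(hy i).1.le, (hy i).2.trans_eq ?_⟩
  simp only [cellCorner]
  ring

lemma abs_center_sub_le {d : ℕ} {c : Fin d → ℝ} {s : ℝ} (hs : 0 < s) {t : ℕ} {l : Fin d → ℕ}
    {y : Fin d → ℝ} (hy : y ∈ cell c s t l) (i : Fin d) :
    |c i + s * ((l i : ℝ) + 1 / 2) / 2 ^ t - y i| ≤ s * (1 / 2) ^ t := by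
  obtain ⟨h1, h2⟩ := hy i
  have h3 : s * ((l i : ℝ) + 1 / 2) / 2 ^ t = s * (l i : ℝ) / 2 ^ t + s / 2 ^ t / 2 := by
    field_simp
  have h4 : s * ((l i : ℝ) + 1) / 2 ^ t = s * (l i : ℝ) / 2 ^ t + s / 2 ^ t := by
    field_simp
  have h5 : s * (1 / 2) ^ t = s / 2 ^ t := by
    rw [one_div, inv_pow, ← div_eq_mul_inv]
  have h6 : 0 < s / 2 ^ t := by positivity
  rw [h3, h5, abs_le]
  rw [h4] at h2
  constructor <;> linarith

lemma exists_cell_fin {d : ℕ} {c : Fin d → ℝ} {s : ℝ} (hs : 0 < s) (t : ℕ) {y : Fin d → ℝ}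
    (hy : y ∈ interior (hypercube c s)) :
    ∃ l₀ : Fin d → Fin (2 ^ t), ∀ l : Fin d → Fin (2 ^ t),
      y ∈ cell c s t (fun i => l i) ↔ l = l₀ := by
  rw [interior_hypercube] at hy
  have hy0 : y ∈ cell c s 0 0 := fun i => by simpa using ⟨(hy i).1.le, (hy i).2⟩
  have hm := cellIndex_mem_cellIndices hs hy0 t
  simp only [cellIndices, Fintype.mem_piFinset, Finset.mem_range] at hm
  refine ⟨fun i => ⟨cellIndex c s t y i, hm i⟩, fun l => ?_⟩
  rw [mem_cell_iff hs (le_of_mem_cell hs hy0), funext_iff, funext_iff]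
  refine forall_congr' fun i => ?_
  rw [Fin.ext_iff, eq_comm]

lemma sum_farBasis {d : ℕ} {a : Fin d → ℝ} {L : ℝ} {t D k : ℕ} {m : Fin d → ℕ}
    {y : Fin d → ℝ} (hy : y ∈ interior (hypercube (cellCorner a L k m) (L / 2 ^ k)))
    {l₀ : Fin d → Fin (2 ^ t)} (hl₀ : ∀ l : Fin d → Fin (2 ^ t),
      y ∈ cell (cellCorner a L k m) (L / 2 ^ k) t (fun i => l i) ↔ l = l₀)
    (g : (Fin d → Fin (2 ^ t)) → ℂ) {P : MvPolynomial (Fin d) ℂ} (hP : P.totalDegree ≤ D) :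
    ∑ b : FarBasisIndex d t D, g b.1 *
      MvPolynomial.coeff (Finsupp.equivFunOnFinite.symm fun i => (b.2 i : ℕ)) P *
        (farBasis a L t D k m b y : ℂ) = MvPolynomial.eval (toComplexPoint y) P * g l₀ := by
  classical
  rw [eval_eq_sum_of_totalDegree_le hP, Fintype.sum_prod_type, Finset.sum_eq_single l₀,
    Finset.sum_mul]
  · refine Finset.sum_congr rfl fun α _ => ?_
    rw [farBasis, if_pos ⟨mem_cell_of_mem_interior hy, (hl₀ l₀).2 rfl⟩]
    simp only [toComplexPoint]
    push_cast
    ring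
  · intro l _ hl
    refine Finset.sum_eq_zero fun α _ => ?_
    rw [farBasis, if_neg fun h => hl ((hl₀ l).1 h.2)]
    simp
  · simp

/-- On a far cell the kernel is, up to a small relative error, a combination of a fixed number of
fixed functions of the source variable. -/
lemma exists_far_approx {𝕜 : Type*} [RCLike 𝕜] {d : ℕ} {a : Fin d → ℝ} {L : ℝ} (hL : 0 < L)
    {σ : Fin d → SignType} {K : (Fin d → ℝ) → (Fin d → ℝ) → 𝕜}
    (hK : FarFieldAnalytic K (hypercube (targetCorner a L σ) L) (hypercube a L))
    {ε : ℝ} (hε : 0 < ε) :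
    ∃ t D : ℕ, ∀ x ∈ interior (hypercube (targetCorner a L σ) L), ∀ k, ∀ m ∈ farIndices σ k,
      ∃ w : FarBasisIndex d t D → 𝕜,
        ∀ y ∈ interior (hypercube (cellCorner a L k m) (L / 2 ^ k)),
          ‖K x y - ∑ b, w b * ((farBasis a L t D k m b y : ℝ) : 𝕜)‖ ≤ ε * ‖K x y‖ := by
  obtain ⟨ρ, C, D, hρ, H⟩ := hK
  have hρ0 : 0 < ρ := by linarith
  have hη : 0 < (ρ + ρ⁻¹ - 2) / 4 := by
    have h1 : ρ + ρ⁻¹ - 2 = (ρ - 1) ^ 2 / ρ := by field_simp; ring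
    rw [h1]
    have : 0 < ρ - 1 := by linarith
    positivity
  set η := (ρ + ρ⁻¹ - 2) / 4 with hηdef
  -- The bound by `η` keeps the subcell centre inside the ball of the Schwarz lemma; the second
  -- bound brings the oscillation factor `(C + 1) / η * (1 / 2) ^ t` below `ε`. The denominator `|C
  -- + 1| + 1` is positive for any sign of `C + 1`.
  obtain ⟨t, ht⟩ := exists_pow_lt_of_lt_one (y := (1 / 2 : ℝ))
    (lt_min hη (div_pos (mul_pos hε hη) (by positivity : 0 < |C + 1| + 1))) (by norm_num)
  obtain ⟨ht1, ht2⟩ := lt_min_iff.1 ht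
  refine ⟨t, D, fun x hx k m hm => ?_⟩
  simp only [farIndices, Finset.mem_filter] at hm
  have hs : 0 < L / 2 ^ k := by positivity
  obtain ⟨P, F, hP, hF, hKF, hC⟩ := H x hx (cellCorner a L k m) (L / 2 ^ k) hs
    (hypercube_cellCorner_subset hL hm.1)
    (fun u hu y hy => le_dist_of_not_touchesTarget hL hm.1 hm.2.2 hu hy)
  let g : (Fin d → Fin (2 ^ t)) → ℂ := fun l =>
    F (toComplexPoint fun i => cellCorner a L k m i + L / 2 ^ k * ((l i : ℝ) + 1 / 2) / 2 ^ t)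
  refine ⟨fun b => RCLike.map ℂ 𝕜 (g b.1 *
    MvPolynomial.coeff (Finsupp.equivFunOnFinite.symm fun i => (b.2 i : ℕ)) P), fun y hy => ?_⟩
  obtain ⟨l₀, hl₀⟩ := exists_cell_fin hs t hy
  have hosc : ‖g l₀ - F (toComplexPoint y)‖ ≤ ε * ‖F (toComplexPoint y)‖ := by
    refine (norm_sub_le_of_bernsteinEllipse hs hη (by linarith) (by positivity) ht1 hF
      (interior_subset hy) (fun z hz => hC z hz y hy)
      (fun i => abs_center_sub_le hs ((hl₀ l₀).2 rfl) i)).trans ?_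
    gcongr
    rw [lt_div_iff₀ (by positivity)] at ht2
    rw [div_mul_eq_mul_div, div_le_iff₀ hη]
    nlinarith [le_abs_self (C + 1), (by positivity : (0 : ℝ) < (1 / 2) ^ t)]
  have hcplx : ‖RCLike.map 𝕜 ℂ (K x y) - ∑ b : FarBasisIndex d t D, g b.1 *
      MvPolynomial.coeff (Finsupp.equivFunOnFinite.symm fun i => (b.2 i : ℕ)) P *
        (farBasis a L t D k m b y : ℂ)‖ ≤ ε * ‖RCLike.map 𝕜 ℂ (K x y)‖ := by
    -- The polynomial factors out of the error, so its zeros do not spoil the relative bound.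
    rw [sum_farBasis hy hl₀ g hP, hKF y hy, ← mul_sub, norm_mul, norm_mul, norm_sub_rev,
      mul_left_comm]
    gcongr
  calc _ = ‖RCLike.map ℂ 𝕜 (RCLike.map 𝕜 ℂ (K x y) - ∑ b : FarBasisIndex d t D, g b.1 *
      MvPolynomial.coeff (Finsupp.equivFunOnFinite.symm fun i => (b.2 i : ℕ)) P *
        (farBasis a L t D k m b y : ℂ))‖ := by
        rw [map_sub, map_sum, rclike_map_map_complex]
        congr 2
        refine Finset.sum_congr rfl fun b _ => ?_
        exact (rclike_map_mul_ofReal _ _).symm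
    _ ≤ ε * ‖RCLike.map 𝕜 ℂ (K x y)‖ := (rclike_norm_map_le _).trans hcplx
    _ ≤ ε * ‖K x y‖ := by gcongr; exact rclike_norm_map_le _

/-! ### The max-norm -/

lemma norm_le_maxNorm {𝕜 : Type*} [RCLike 𝕜] {n : ℕ} (A : Matrix (Fin n) (Fin n) 𝕜) (i j : Fin n) :
    ‖A i j‖ ≤ maxNorm A :=
  le_ciSup (f := fun q : Fin n × Fin n => ‖A q.1 q.2‖) (Set.finite_range _).bddAbove (i, j)

lemma maxNorm_le {𝕜 : Type*} [RCLike 𝕜] {n : ℕ} {A : Matrix (Fin n) (Fin n) 𝕜} {c : ℝ}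
    (hc : 0 ≤ c) (h : ∀ i j, ‖A i j‖ ≤ c) : maxNorm A ≤ c :=
  Real.iSup_le (fun q => h q.1 q.2) hc

lemma maxNorm_pos {𝕜 : Type*} [RCLike 𝕜] {n : ℕ} {A : Matrix (Fin n) (Fin n) 𝕜} (hA : A ≠ 0) :
    0 < maxNorm A := by
  obtain ⟨i, j, hij⟩ : ∃ i j, A i j ≠ 0 := by
    by_contra! h
    exact hA (Matrix.ext h)
  exact (norm_pos_iff.2 hij).trans_le (norm_le_maxNorm A i j)

lemma maxNorm_div_lt {𝕜 : Type*} [RCLike 𝕜] {n : ℕ} {A B : Matrix (Fin n) (Fin n) 𝕜} (hB : B ≠ 0)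
    {δ : ℝ} (hδ : 0 < δ) (h : ∀ i j, ‖A i j‖ ≤ δ / 2 * maxNorm B) : maxNorm A / maxNorm B < δ := by
  have hpos := maxNorm_pos hB
  rw [div_lt_iff₀ hpos]
  have := maxNorm_le (by positivity) h
  nlinarith

/-! ### Ranks -/

/-- Such a matrix is unchanged by multiplication with the diagonal projection onto `S`. -/
lemma rank_le_card_of_eq_zero {𝕜 : Type*} [RCLike 𝕜] {n : ℕ} {A : Matrix (Fin n) (Fin n) 𝕜}
    (S : Finset (Fin n)) (h : ∀ i, ∀ j ∉ S, A i j = 0) : A.rank ≤ S.card := by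
  classical
  have hA : A = A * Matrix.diagonal (fun j => if j ∈ S then (1 : 𝕜) else 0) := by
    ext i j
    rw [Matrix.mul_diagonal]
    by_cases hj : j ∈ S <;> simp [hj, h i j]
  rw [hA]
  refine (Matrix.rank_mul_le_right _ _).trans ?_
  rw [Matrix.rank_diagonal]
  simp

lemma rank_le_card_of_eq_sum {𝕜 : Type*} [RCLike 𝕜] {n : ℕ} {B : Type*} [Fintype B]
    {A : Matrix (Fin n) (Fin n) 𝕜} (w v : Fin n → B → 𝕜)
    (h : ∀ i j, A i j = ∑ b, w i b * v j b) : A.rank ≤ Fintype.card B := by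
  have hA : A = Matrix.of w * Matrix.of fun b j => v j b := by
    ext i j
    simp [Matrix.mul_apply, h]
  rw [hA]
  exact (Matrix.rank_mul_le_left _ _).trans (Matrix.rank_le_card_width _)

lemma rank_add_le_rank_add_rank {𝕜 : Type*} [RCLike 𝕜] {n : ℕ} (A B : Matrix (Fin n) (Fin n) 𝕜) :
    (A + B).rank ≤ A.rank + B.rank := by
  rw [Matrix.rank, Matrix.rank, Matrix.rank, Matrix.mulVecLin_add]
  exact (Submodule.finrank_mono (LinearMap.range_add_le _ _)).trans
    (Submodule.finrank_add_le_finrank_add_finrank _ _)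

lemma rank_sum_le {𝕜 : Type*} [RCLike 𝕜] {n : ℕ} {ι : Type*} (s : Finset ι)
    (A : ι → Matrix (Fin n) (Fin n) 𝕜) : (∑ k ∈ s, A k).rank ≤ ∑ k ∈ s, (A k).rank := by
  classical
  induction s using Finset.induction_on with
  | empty => simp
  | insert k s hk ih =>
    rw [Finset.sum_insert hk, Finset.sum_insert hk]
    exact (rank_add_le_rank_add_rank _ _).trans (by gcongr)

/-! ### Measurable choice of the coefficients -/

/-- The strict inequalities define an open set of coefficients, so if it is nonempty it meets a
fixed dense sequence; the first index that works depends measurably on `ω`. -/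
lemma exists_measurable_coeff {𝕜 : Type*} [RCLike 𝕜] {Ω : Type*} [MeasurableSpace Ω]
    {ι B : Type*} [Finite ι] [Fintype B] {f : ι → Ω → 𝕜} (hf : ∀ j, Measurable (f j))
    {v : ι → B → Ω → ℝ} (hv : ∀ j b, Measurable (v j b)) {τ : Ω → ℝ} (hτ : Measurable τ) :
    ∃ c : Ω → B → 𝕜, (∀ b, Measurable fun ω => c ω b) ∧
      ∀ ω, (∃ w : B → 𝕜, ∀ j, ‖f j ω - ∑ b, w b * (v j b ω : 𝕜)‖ < τ ω) →
        ∀ j, ‖f j ω - ∑ b, c ω b * (v j b ω : 𝕜)‖ < τ ω := by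
  classical
  let u : ℕ → B → 𝕜 := TopologicalSpace.denseSeq (B → 𝕜)
  let q : Ω → ℕ → Prop := fun ω N => ∀ j, ‖f j ω - ∑ b, u N b * (v j b ω : 𝕜)‖ < τ ω
  have hq : ∀ N, MeasurableSet {ω | q ω N} := by
    intro N
    have : {ω | q ω N} = ⋂ j, {ω | ‖f j ω - ∑ b, u N b * (v j b ω : 𝕜)‖ < τ ω} := by
      ext ω; simp [q]
    rw [this]
    refine MeasurableSet.iInter fun j => measurableSet_lt (Measurable.norm ?_) hτ
    refine (hf j).sub (Finset.measurable_sum _ fun b _ => measurable_const.mul ?_)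
    exact RCLike.measurable_ofReal.comp (hv j b)
  -- The second alternative makes the search terminate where no solution exists.
  have hex : ∀ ω, ∃ N, q ω N ∨ ∀ M, ¬ q ω M := by
    intro ω
    by_cases h : ∃ N, q ω N
    · exact h.imp fun N hN => Or.inl hN
    · exact ⟨0, Or.inr (not_exists.1 h)⟩
  have hmeas : Measurable fun ω => Nat.find (hex ω) := by
    refine measurable_find hex fun N => ?_
    have : {ω | q ω N ∨ ∀ M, ¬ q ω M} = {ω | q ω N} ∪ ⋂ M, {ω | q ω M}ᶜ := by ext ω; simp
    rw [this]
    exact (hq N).union (MeasurableSet.iInter fun M => (hq M).compl)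
  refine ⟨fun ω => u (Nat.find (hex ω)), fun b => ?_, ?_⟩
  · exact (measurable_from_nat (f := fun N => u N b)).comp hmeas
  · rintro ω ⟨w, hw⟩
    have hopen : IsOpen {w : B → 𝕜 | ∀ j, ‖f j ω - ∑ b, w b * (v j b ω : 𝕜)‖ < τ ω} := by
      rw [Set.ofPred_forall]
      exact isOpen_iInter_of_finite fun j => isOpen_lt (by fun_prop) continuous_const
    obtain ⟨N, hN⟩ := (TopologicalSpace.denseRange_denseSeq (B → 𝕜)).exists_mem_open hopen ⟨w, hw⟩
    rcases Nat.find_spec (hex ω) with h | h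
    · exact h
    · exact absurd hN (h N)

/-! ### The hierarchical approximation of one configuration -/

open Classical in
lemma sum_blockMatrix {𝕜 : Type*} [RCLike 𝕜] {d n : ℕ} {a : Fin d → ℝ} {L : ℝ} (hL : 0 < L)
    (σ : Fin d → SignType) (K : (Fin d → ℝ) → (Fin d → ℝ) → 𝕜) (x : Fin n → Fin d → ℝ)
    {y : Fin n → Fin d → ℝ} (hy : ∀ j, y j ∈ cell a L 0 0) :
    assemble σ (fun k m => blockMatrix K x y (cell a L k m))
      (blockMatrix K x y (nearRegion a L σ (depth d n))) = kernelMatrix K x y := by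
  ext i j
  simp only [assemble, Matrix.add_apply, Matrix.sum_apply, blockMatrix, Matrix.of_apply,
    kernelMatrix]
  exact sum_far_add_near hL σ (hy j) (K (x i) (y j)) (depth d n)

lemma isHierarchicalApprox_of_coeff {𝕜 : Type*} [RCLike 𝕜] {d n t D : ℕ} {a : Fin d → ℝ} {L : ℝ}
    (hL : 0 < L) (σ : Fin d → SignType) (K : (Fin d → ℝ) → (Fin d → ℝ) → 𝕜) {δ : ℝ} (hδ : 0 < δ)
    (x : Fin n → Fin d → ℝ) {y : Fin n → Fin d → ℝ}
    {w : ℕ → (Fin d → ℕ) → Fin n → FarBasisIndex d t D → 𝕜}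
    (hy : kernelMatrix K x y ≠ 0 → ∀ j, y j ∈ cell a L 0 0)
    (hw : kernelMatrix K x y ≠ 0 → ∀ k, ∀ m ∈ farIndices σ k, ∀ i j,
      ‖blockMatrix K x y (cell a L k m) i j -
        ∑ b, w k m i b * ((farBasis a L t D k m b (y j) : ℝ) : 𝕜)‖ ≤
          δ / 2 * maxNorm (kernelMatrix K x y)) :
    IsHierarchicalApprox K a L σ δ (Fintype.card (FarBasisIndex d t D)) x y
      (fun k m => Matrix.of fun i j =>
        ∑ b, w k m i b * ((farBasis a L t D k m b (y j) : ℝ) : 𝕜))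
      (blockMatrix K x y (nearRegion a L σ (depth d n))) := by
  classical
  have hfar : ∀ k m, (Matrix.of fun i j =>
        ∑ b, w k m i b * ((farBasis a L t D k m b (y j) : ℝ) : 𝕜)).rank ≤
      min (particleCount y (cell a L k m)) (Fintype.card (FarBasisIndex d t D)) := by
    intro k m
    refine le_min (rank_le_card_of_eq_zero _ fun i j hj => ?_)
      (rank_le_card_of_eq_sum (w k m) _ fun i j => rfl)
    have hj' : y j ∉ cell a L k m := by simpa using hj
    simp [farBasis_eq_zero _ hj']
  have hnear : (blockMatrix K x y (nearRegion a L σ (depth d n))).rank ≤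
      particleCount y (nearRegion a L σ (depth d n)) := by
    refine rank_le_card_of_eq_zero _ fun i j hj => ?_
    have hj' : y j ∉ nearRegion a L σ (depth d n) := by simpa using hj
    simp [blockMatrix, hj']
  refine ⟨fun k _ m _ => hfar k m, hnear, ?_, fun hK k _ m hm => ?_, fun hK => ?_, fun hK => ?_⟩
  · refine (rank_add_le_rank_add_rank _ _).trans (add_le_add ?_ hnear)
    refine (rank_sum_le _ _).trans (Finset.sum_le_sum fun k _ => ?_)
    exact (rank_sum_le _ _).trans (Finset.sum_le_sum fun m _ => hfar k m)
  · exact maxNorm_div_lt hK hδ (hw hK k m hm)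
  · refine maxNorm_div_lt hK hδ fun i j => ?_
    have := (maxNorm_pos hK).le
    simp only [sub_self, Matrix.zero_apply, norm_zero]
    positivity
  · refine maxNorm_div_lt hK hδ fun i j => ?_
    set c := δ / 2 * maxNorm (kernelMatrix K x y) with hc
    have hc0 : 0 ≤ c := by
      have := (maxNorm_pos hK).le
      positivity
    -- Both blocks vanish in columns outside the cell, so summing these bounds over the partition
    -- gives at most one copy of `c`.
    have hterm : ∀ k, ∀ m ∈ farIndices σ k, ‖blockMatrix K x y (cell a L k m) i j -
        ∑ b, w k m i b * ((farBasis a L t D k m b (y j) : ℝ) : 𝕜)‖ ≤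
          if y j ∈ cell a L k m then c else 0 := by
      intro k m hm
      split_ifs with hj
      · exact hw hK k m hm i j
      · simp [blockMatrix, hj, farBasis_eq_zero _ hj]
    have hpart := sum_far_add_near hL σ (hy hK j) c (depth d n)
    nth_rewrite 1 [← sum_blockMatrix hL σ K x (hy hK)]
    simp only [assemble, Matrix.sub_apply, Matrix.add_apply, add_sub_add_right_eq_sub]
    simp only [Matrix.sum_apply, ← Finset.sum_sub_distrib, Matrix.of_apply]
    refine (norm_sum_le_of_le _ fun k _ => norm_sum_le_of_le _ fun m hm => hterm k m hm).trans ?_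
    have : 0 ≤ if y j ∈ nearRegion a L σ (depth d n) then c else 0 := by split_ifs <;> simp [hc0]
    linarith

/-! ### Uniformly distributed points and the subdivision -/

lemma cell_eq_pi {d : ℕ} (a : Fin d → ℝ) (L : ℝ) (k : ℕ) (m : Fin d → ℕ) :
    cell a L k m = Set.univ.pi fun i =>
      Set.Ico (a i + L * (m i : ℝ) / 2 ^ k) (a i + L * ((m i : ℝ) + 1) / 2 ^ k) := by
  ext y
  simp [cell]

lemma measurableSet_cell {d : ℕ} (a : Fin d → ℝ) (L : ℝ) (k : ℕ) (m : Fin d → ℕ) :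
    MeasurableSet (cell a L k m) := by
  rw [cell_eq_pi]
  exact MeasurableSet.univ_pi fun i => measurableSet_Ico

lemma measurableSet_nearRegion {d : ℕ} (a : Fin d → ℝ) (L : ℝ) (σ : Fin d → SignType) (k : ℕ) :
    MeasurableSet (nearRegion a L σ k) :=
  Finset.measurableSet_biUnion _ fun m _ => measurableSet_cell a L k m

/-- The dyadic hyperplanes are countably many null sets. Off them, half-open cells and open cubes
contain the same particles. -/
lemma ae_generic_of_isUniform {d : ℕ} {c : Fin d → ℝ} {L : ℝ} {Ω : Type*} [MeasurableSpace Ω]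
    {μ : Measure Ω} {X : Ω → Fin d → ℝ} (hX : Measurable X)
    (hu : pdf.IsUniform X (hypercube c L) μ volume) :
    ∀ᵐ ω ∂μ, X ω ∈ hypercube c L ∧ ∀ i, ∀ k m : ℕ, X ω i ≠ c i + L * m / 2 ^ k := by
  have h1 : ∀ᵐ ω ∂μ, X ω ∈ hypercube c L := by
    refine ae_of_ae_map hX.aemeasurable ?_
    rw [show Measure.map X μ = _ from hu]
    exact ae_cond_mem measurableSet_Icc
  have h2 : ∀ᵐ ω ∂μ, ∀ i, ∀ k m : ℕ, X ω i ≠ c i + L * m / 2 ^ k := by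
    simp only [ae_all_iff]
    intro i k m
    refine ae_of_ae_map (p := fun y : Fin d → ℝ => y i ≠ c i + L * m / 2 ^ k) hX.aemeasurable
      (hu.absolutelyContinuous.ae_le (ae_iff.2 ?_))
    simp only [ne_eq, not_not]
    rw [volume_pi]
    exact Measure.pi_hyperplane _ _ _
  exact h1.and h2

lemma mem_interior_of_generic {d : ℕ} {c : Fin d → ℝ} {L : ℝ} {y : Fin d → ℝ}
    (hy : y ∈ hypercube c L) (hg : ∀ i, ∀ k m : ℕ, y i ≠ c i + L * m / 2 ^ k) :
    y ∈ interior (hypercube c L) := by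
  rw [interior_hypercube]
  refine fun i => ⟨lt_of_le_of_ne (hy.1 i) ?_, lt_of_le_of_ne (hy.2 i) ?_⟩
  · simpa [eq_comm] using hg i 0 0
  · simpa using hg i 0 1

lemma mem_interior_cell_of_generic {d : ℕ} {a : Fin d → ℝ} {L : ℝ} {y : Fin d → ℝ}
    (hg : ∀ i, ∀ k m : ℕ, y i ≠ a i + L * m / 2 ^ k) {k : ℕ} {m : Fin d → ℕ}
    (hy : y ∈ cell a L k m) : y ∈ interior (hypercube (cellCorner a L k m) (L / 2 ^ k)) := by
  rw [interior_hypercube]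
  intro i
  refine ⟨lt_of_le_of_ne (hy i).1 (hg i k (m i)).symm, (hy i).2.trans_eq ?_⟩
  simp only [cellCorner]
  ring

lemma mem_cell_zero_of_generic {d : ℕ} {a : Fin d → ℝ} {L : ℝ} {y : Fin d → ℝ}
    (hy : y ∈ hypercube a L) (hg : ∀ i, ∀ k m : ℕ, y i ≠ a i + L * m / 2 ^ k) :
    y ∈ cell a L 0 0 := by
  have h := mem_interior_of_generic hy hg
  rw [interior_hypercube] at h
  exact fun i => by simpa using ⟨(h i).1.le, (h i).2⟩

lemma cell_subset_hypercube {d : ℕ} {a : Fin d → ℝ} {L : ℝ} (hL : 0 < L) {k : ℕ}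
    {m : Fin d → ℕ} (hm : m ∈ cellIndices d k) : cell a L k m ⊆ hypercube a L := by
  refine fun y hy => hypercube_cellCorner_subset hL hm ⟨fun i => (hy i).1, fun i => ?_⟩
  refine (hy i).2.le.trans_eq ?_
  simp only [cellCorner]
  ring

lemma measureReal_preimage_cell {d : ℕ} {a : Fin d → ℝ} {L : ℝ} (hL : 0 < L) {Ω : Type*}
    [MeasurableSpace Ω] {μ : Measure Ω} {Y : Ω → Fin d → ℝ} (hY : Measurable Y)
    (hu : pdf.IsUniform Y (hypercube a L) μ volume) {k : ℕ} {m : Fin d → ℕ}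
    (hm : m ∈ cellIndices d k) : μ.real (Y ⁻¹' cell a L k m) = ((2 : ℝ) ^ (d * k))⁻¹ := by
  have hvol : (volume (hypercube a L)).toReal = L ^ d := by
    rw [hypercube, Real.volume_Icc_pi]
    simp [hL.le]
  have hcell : (volume (cell a L k m)).toReal = (L / 2 ^ k) ^ d := by
    rw [cell_eq_pi, Real.volume_pi_Ico, ENNReal.toReal_prod]
    have : ∀ i, a i + L * ((m i : ℝ) + 1) / 2 ^ k - (a i + L * (m i : ℝ) / 2 ^ k) = L / 2 ^ k :=
      fun i => by ring
    simp only [this]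
    rw [ENNReal.toReal_ofReal (by positivity), Finset.prod_const, Finset.card_univ,
      Fintype.card_fin]
  have hms : MeasurableSet (hypercube a L) := measurableSet_Icc
  rw [Measure.real, ← Measure.map_apply hY (measurableSet_cell a L k m),
    show Measure.map Y μ = _ from hu, cond_apply hms,
    Set.inter_eq_self_of_subset_right (cell_subset_hypercube hL hm), ENNReal.toReal_mul,
    ENNReal.toReal_inv, hvol, hcell, div_pow, ← pow_mul, mul_comm k d]
  have : L ^ d ≠ 0 := by positivity
  field_simp

lemma measureReal_preimage_nearRegion_le {d : ℕ} {a : Fin d → ℝ} {L : ℝ} (hL : 0 < L)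
    (σ : Fin d → SignType) {Ω : Type*} [MeasurableSpace Ω] {μ : Measure Ω}
    [IsProbabilityMeasure μ] {Y : Ω → Fin d → ℝ} (hY : Measurable Y)
    (hu : pdf.IsUniform Y (hypercube a L) μ volume) (k : ℕ) :
    μ.real (Y ⁻¹' nearRegion a L σ k) ≤
      2 ^ ((Finset.univ.filter fun i => σ i = 0).card * k) * ((2 : ℝ) ^ (d * k))⁻¹ := by
  rw [nearRegion, Set.preimage_iUnion₂]
  refine (measureReal_biUnion_finset_le _ _).trans ?_
  rw [Finset.sum_congr rfl fun m hm =>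
    measureReal_preimage_cell hL hY hu (Finset.mem_filter.1 hm).1, Finset.sum_const, nsmul_eq_mul]
  gcongr
  exact_mod_cast card_touching_le σ k

/-! ### Measurable hierarchical approximation -/

lemma measurable_farBasis {d : ℕ} (a : Fin d → ℝ) (L : ℝ) (t D k : ℕ) (m : Fin d → ℕ)
    (b : FarBasisIndex d t D) : Measurable (farBasis a L t D k m b) := by
  unfold farBasis
  refine Measurable.ite ?_ (by fun_prop) measurable_const
  exact (measurableSet_cell a L k m).inter (measurableSet_cell _ _ _ _)

lemma measurable_blockMatrix {𝕜 : Type*} [RCLike 𝕜] {d n : ℕ} {Ω : Type*} [MeasurableSpace Ω]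
    {K : (Fin d → ℝ) → (Fin d → ℝ) → 𝕜} (hKm : Measurable (Function.uncurry K))
    {x y : Fin n → Ω → Fin d → ℝ} (hx : ∀ i, Measurable (x i)) (hy : ∀ i, Measurable (y i))
    {V : Set (Fin d → ℝ)} (hV : MeasurableSet V) (i j : Fin n) :
    Measurable fun ω => blockMatrix K (fun i => x i ω) (fun j => y j ω) V i j := by
  simp only [blockMatrix, Matrix.of_apply]
  exact Measurable.ite (hy j hV) (hKm.comp ((hx i).prodMk (hy j))) measurable_const

lemma measurable_maxNorm_kernelMatrix {𝕜 : Type*} [RCLike 𝕜] {d n : ℕ} {Ω : Type*}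
    [MeasurableSpace Ω] {K : (Fin d → ℝ) → (Fin d → ℝ) → 𝕜}
    (hKm : Measurable (Function.uncurry K)) {x y : Fin n → Ω → Fin d → ℝ}
    (hx : ∀ i, Measurable (x i)) (hy : ∀ i, Measurable (y i)) :
    Measurable fun ω => maxNorm (kernelMatrix K (fun i => x i ω) (fun j => y j ω)) :=
  Measurable.iSup fun q => (hKm.comp ((hx q.1).prodMk (hy q.2))).norm

lemma exists_measurable_hierarchicalApprox {𝕜 : Type*} [RCLike 𝕜] {d : ℕ} {a : Fin d → ℝ} {L : ℝ}
    (hL : 0 < L) (σ : Fin d → SignType) {K : (Fin d → ℝ) → (Fin d → ℝ) → 𝕜}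
    (hKm : Measurable (Function.uncurry K))
    {δ : ℝ} (hδ : 0 < δ) {t D : ℕ}
    (hfar : ∀ x ∈ interior (hypercube (targetCorner a L σ) L), ∀ k, ∀ m ∈ farIndices σ k,
      ∃ w : FarBasisIndex d t D → 𝕜,
        ∀ y ∈ interior (hypercube (cellCorner a L k m) (L / 2 ^ k)),
          ‖K x y - ∑ b, w b * ((farBasis a L t D k m b y : ℝ) : 𝕜)‖ ≤ δ / 4 * ‖K x y‖)
    {Ω : Type*} [MeasurableSpace Ω] {μ : Measure Ω} {n : ℕ} {x y : Fin n → Ω → Fin d → ℝ}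
    (hx : ∀ i, Measurable (x i)) (hy : ∀ i, Measurable (y i))
    (hux : ∀ i, pdf.IsUniform (x i) (hypercube (targetCorner a L σ) L) μ volume)
    (huy : ∀ i, pdf.IsUniform (y i) (hypercube a L) μ volume) :
    ∃ (Kfar : Ω → ℕ → (Fin d → ℕ) → Matrix (Fin n) (Fin n) 𝕜)
          (Knear : Ω → Matrix (Fin n) (Fin n) 𝕜),
        (∀ k m i j, Measurable fun ω => Kfar ω k m i j) ∧
        (∀ i j, Measurable fun ω => Knear ω i j) ∧
        ∀ᵐ ω ∂μ, IsHierarchicalApprox K a L σ δ (Fintype.card (FarBasisIndex d t D))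
          (fun i => x i ω) (fun j => y j ω) (Kfar ω) (Knear ω) := by
  classical
  have hτ : Measurable fun ω =>
      δ / 2 * maxNorm (kernelMatrix K (fun i => x i ω) (fun j => y j ω)) :=
    (measurable_maxNorm_kernelMatrix hKm hx hy).const_mul _
  have hv : ∀ k m j b, Measurable fun ω => farBasis a L t D k m b (y j ω) :=
    fun k m j b => (measurable_farBasis a L t D k m b).comp (hy j)
  choose w hwm hw using fun (k : ℕ) (m : Fin d → ℕ) (i : Fin n) =>
    exists_measurable_coeff
      (f := fun j ω => blockMatrix K (fun i => x i ω) (fun j => y j ω) (cell a L k m) i j)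
      (fun j => measurable_blockMatrix hKm hx hy (measurableSet_cell a L k m) i j)
      (v := fun j b ω => farBasis a L t D k m b (y j ω)) (hv k m) hτ
  refine ⟨fun ω k m => Matrix.of fun i j =>
      ∑ b, w k m i ω b * ((farBasis a L t D k m b (y j ω) : ℝ) : 𝕜),
    fun ω => blockMatrix K (fun i => x i ω) (fun j => y j ω) (nearRegion a L σ (depth d n)),
    fun k m i j => ?_, measurable_blockMatrix hKm hx hy (measurableSet_nearRegion a L σ _), ?_⟩
  · exact Finset.measurable_sum _ fun b _ =>
      (hwm k m i b).mul (RCLike.measurable_ofReal.comp (hv k m j b))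
  · filter_upwards [ae_all_iff.2 fun i => ae_generic_of_isUniform (hx i) (hux i),
      ae_all_iff.2 fun j => ae_generic_of_isUniform (hy j) (huy j)] with ω hxω hyω
    refine isHierarchicalApprox_of_coeff hL σ K hδ (fun i => x i ω) (w := fun k m i => w k m i ω)
      (fun _ j => mem_cell_zero_of_generic (hyω j).1 (hyω j).2) ?_
    intro hK k m hm i j
    refine (hw k m i ω ?_ j).le
    obtain ⟨w₀, hw₀⟩ := hfar (x i ω) (mem_interior_of_generic (hxω i).1 (hxω i).2) k m hm
    refine ⟨w₀, fun j => ?_⟩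
    have hpos := maxNorm_pos hK
    by_cases hj : y j ω ∈ cell a L k m
    · have h1 := hw₀ _ (mem_interior_cell_of_generic (hyω j).2 hj)
      have h2 := norm_le_maxNorm (kernelMatrix K (fun i => x i ω) (fun j => y j ω)) i j
      simp only [kernelMatrix, Matrix.of_apply] at h2
      simp only [blockMatrix, Matrix.of_apply, hj, if_true]
      refine h1.trans_lt ?_
      calc δ / 4 * ‖K (x i ω) (y j ω)‖ ≤ δ / 4 *
          maxNorm (kernelMatrix K (fun i => x i ω) (fun j => y j ω)) := by gcongr; exact h2
        -- Passing from `δ / 4` to `δ / 2` yields the strict inequality required by the measurable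
        -- selection, as the norm is positive.
        _ < _ := by nlinarith
    · simp only [blockMatrix, Matrix.of_apply, hj, if_false, farBasis_eq_zero _ hj]
      simp only [RCLike.ofReal_zero, mul_zero, Finset.sum_const_zero, sub_self, norm_zero]
      positivity

/-! ### Variance of sums -/

/-- Cauchy–Schwarz, read off from the nonnegative variance of `e * X - c * Y`. -/
lemma covariance_le_mul {Ω : Type*} [MeasurableSpace Ω] {μ : Measure Ω} [IsFiniteMeasure μ]
    {X Y : Ω → ℝ} (hX : MemLp X 2 μ) (hY : MemLp Y 2 μ) {c e : ℝ} (hc : 0 < c) (he : 0 < e)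
    (hVX : Var[X; μ] ≤ c ^ 2) (hVY : Var[Y; μ] ≤ e ^ 2) : cov[X, Y; μ] ≤ c * e := by
  have h := variance_nonneg (fun ω => e * X ω - c * Y ω) μ
  rw [variance_fun_sub (hX.const_mul e) (hY.const_mul c), variance_const_mul, variance_const_mul,
    covariance_const_mul_left, covariance_const_mul_right] at h
  have hce : 0 < c * e := mul_pos hc he
  by_contra! hlt
  nlinarith [mul_le_mul_of_nonneg_left hVX (sq_nonneg e),
    mul_le_mul_of_nonneg_left hVY (sq_nonneg c), mul_lt_mul_of_pos_left hlt hce]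

lemma variance_add_le_sq {Ω : Type*} [MeasurableSpace Ω] {μ : Measure Ω} [IsFiniteMeasure μ]
    {X Y : Ω → ℝ} (hX : MemLp X 2 μ) (hY : MemLp Y 2 μ) {c e : ℝ} (hc : 0 < c) (he : 0 < e)
    (hVX : Var[X; μ] ≤ c ^ 2) (hVY : Var[Y; μ] ≤ e ^ 2) :
    Var[fun ω => X ω + Y ω; μ] ≤ (c + e) ^ 2 := by
  rw [variance_fun_add hX hY]
  nlinarith [covariance_le_mul hX hY hc he hVX hVY]

lemma variance_sum_le_sq {Ω ι : Type*} [MeasurableSpace Ω] {μ : Measure Ω} [IsFiniteMeasure μ]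
    {s : Finset ι} {X : ι → Ω → ℝ} (hX : ∀ i ∈ s, MemLp (X i) 2 μ) {c : ι → ℝ}
    (hc : ∀ i ∈ s, 0 < c i) (hV : ∀ i ∈ s, Var[X i; μ] ≤ c i ^ 2) :
    Var[fun ω => ∑ i ∈ s, X i ω; μ] ≤ (∑ i ∈ s, c i) ^ 2 := by
  rw [variance_fun_sum' hX, sq, Finset.sum_mul_sum]
  exact Finset.sum_le_sum fun i hi => Finset.sum_le_sum fun j hj =>
    covariance_le_mul (hX i hi) (hX j hj) (hc i hi) (hc j hj) (hV i hi) (hV j hj)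

/-! ### Variance of particle counts -/

lemma particleCount_eq_sum {d n : ℕ} (y : Fin n → Fin d → ℝ) (V : Set (Fin d → ℝ)) :
    (particleCount y V : ℝ) = ∑ j, V.indicator (fun _ => (1 : ℝ)) (y j) := by
  classical
  rw [particleCount, Finset.card_filter]
  push_cast
  exact Finset.sum_congr rfl fun j _ => by simp [Set.indicator_apply]

lemma particleCount_le {d n : ℕ} (y : Fin n → Fin d → ℝ) (V : Set (Fin d → ℝ)) :
    particleCount y V ≤ n :=
  (Finset.card_le_univ _).trans_eq (Fintype.card_fin n)

lemma integral_indicator_comp {d : ℕ} {Ω : Type*} [MeasurableSpace Ω] {μ : Measure Ω}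
    {Y : Ω → Fin d → ℝ} (hY : Measurable Y) {V : Set (Fin d → ℝ)} (hV : MeasurableSet V) :
    ∫ ω, V.indicator (fun _ => (1 : ℝ)) (Y ω) ∂μ = μ.real (Y ⁻¹' V) :=
  integral_indicator_one (hY hV)

section Counts

variable {d n : ℕ} {Ω : Type*} [MeasurableSpace Ω] {μ : Measure Ω} [IsProbabilityMeasure μ]
  {y : Fin n → Ω → Fin d → ℝ} {V : Set (Fin d → ℝ)}

lemma memLp_indicator_comp {Y : Ω → Fin d → ℝ} (hY : Measurable Y) (hV : MeasurableSet V) :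
    MemLp (fun ω => V.indicator (fun _ => (1 : ℝ)) (Y ω)) 2 μ := by
  refine MemLp.of_bound ((measurable_const.indicator hV).comp hY).aestronglyMeasurable 1
    (ae_of_all _ fun ω => ?_)
  by_cases h : Y ω ∈ V <;> simp [h]

lemma measurable_particleCount (hy : ∀ j, Measurable (y j)) (hV : MeasurableSet V) :
    Measurable fun ω => (particleCount (fun j => y j ω) V : ℝ) := by
  simp only [particleCount_eq_sum]
  exact Finset.measurable_sum _ fun j _ => (measurable_const.indicator hV).comp (hy j)

lemma memLp_particleCount (hy : ∀ j, Measurable (y j)) (hV : MeasurableSet V) :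
    MemLp (fun ω => (particleCount (fun j => y j ω) V : ℝ)) 2 μ := by
  refine MemLp.of_bound (measurable_particleCount hy hV).aestronglyMeasurable n
    (ae_of_all _ fun ω => ?_)
  rw [Real.norm_of_nonneg (Nat.cast_nonneg _)]
  exact_mod_cast particleCount_le _ _

lemma memLp_min_particleCount (hy : ∀ j, Measurable (y j)) (hV : MeasurableSet V) (p : ℕ) :
    MemLp (fun ω => ((min (particleCount (fun j => y j ω) V) p : ℕ) : ℝ)) 2 μ := by
  simp only [Nat.cast_min]
  refine MemLp.of_bound
    ((measurable_particleCount hy hV).min measurable_const).aestronglyMeasurable n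
    (ae_of_all _ fun ω => ?_)
  rw [← Nat.cast_min, Real.norm_of_nonneg (Nat.cast_nonneg _)]
  exact_mod_cast (min_le_left _ _).trans (particleCount_le _ _)

lemma integral_particleCount (hy : ∀ j, Measurable (y j)) (hV : MeasurableSet V) {q : ℝ}
    (hq : ∀ j, μ.real (y j ⁻¹' V) = q) :
    ∫ ω, (particleCount (fun j => y j ω) V : ℝ) ∂μ = n * q := by
  simp only [particleCount_eq_sum]
  rw [integral_finsetSum _ fun j _ => (memLp_indicator_comp (hy j) hV).integrable one_le_two]
  simp [integral_indicator_comp (hy _) hV, hq]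

lemma variance_particleCount_le (hy : ∀ j, Measurable (y j)) (hind : iIndepFun y μ)
    (hV : MeasurableSet V) {q : ℝ} (hq : ∀ j, μ.real (y j ⁻¹' V) ≤ q) :
    Var[fun ω => (particleCount (fun j => y j ω) V : ℝ); μ] ≤ n * q := by
  have hsum : (fun ω => (particleCount (fun j => y j ω) V : ℝ)) =
      ∑ j, fun ω => V.indicator (fun _ => (1 : ℝ)) (y j ω) := by
    ext ω
    simp [particleCount_eq_sum]
  rw [hsum, IndepFun.variance_sum (fun j _ => memLp_indicator_comp (hy j) hV)
    fun i _ j _ hij => (hind.indepFun hij).comp (measurable_const.indicator hV)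
      (measurable_const.indicator hV)]
  refine (Finset.sum_le_card_nsmul _ _ q fun j _ => ?_).trans_eq (by simp)
  refine (variance_le_expectation_sq (memLp_indicator_comp (hy j) hV).1).trans
    (le_trans (le_of_eq ?_) (hq j))
  rw [← integral_indicator_comp (hy j) hV]
  refine integral_congr_ae (ae_of_all _ fun ω => ?_)
  by_cases h : y j ω ∈ V <;> simp [h]

/-- Truncated counts have a small variance when the mean is large. -/
lemma variance_min_particleCount_le (hy : ∀ j, Measurable (y j)) (hind : iIndepFun y μ)
    (hV : MeasurableSet V) {q : ℝ} (hq : ∀ j, μ.real (y j ⁻¹' V) = q) (hnq : 0 < n * q) {p : ℕ}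
    (hp : 1 ≤ p) :
    Var[fun ω => ((min (particleCount (fun j => y j ω) V) p : ℕ) : ℝ); μ] ≤
      4 * p ^ 4 / (n * q) := by
  have hp1 : (1 : ℝ) ≤ p := by exact_mod_cast hp
  have hmin := memLp_min_particleCount (μ := μ) hy hV p
  have hdiff : MemLp (fun ω => (p : ℝ) - ((min (particleCount (fun j => y j ω) V) p : ℕ) : ℝ)) 2 μ :=
    (memLp_const _).sub hmin
  -- The deficit `p - min N p` vanishes unless `N < p`, so its second moment is a good bound.
  rw [← variance_const_sub hmin.1 (p : ℝ)]
  refine (variance_le_expectation_sq hdiff.1).trans ?_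
  simp only [Pi.pow_apply]
  have hbound : ∀ ω, 0 ≤ (p : ℝ) - ((min (particleCount (fun j => y j ω) V) p : ℕ) : ℝ) ∧
      (p : ℝ) - ((min (particleCount (fun j => y j ω) V) p : ℕ) : ℝ) ≤ p := by
    intro ω
    have h1 : ((min (particleCount (fun j => y j ω) V) p : ℕ) : ℝ) ≤ p := by
      exact_mod_cast min_le_right _ _
    exact ⟨sub_nonneg.2 h1, sub_le_self _ (Nat.cast_nonneg _)⟩
  set lam : ℝ := n * q with hlam
  -- If `2 * p ≤ lam`, then `N < p` forces a deviation of at least `lam / 2` from the mean, and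
  -- Chebyshev's argument applies. Otherwise the trivial bound `p ^ 2` suffices.
  rcases le_or_gt (2 * (p : ℝ)) lam with hle | hlt
  · have hmean := integral_particleCount (μ := μ) hy hV hq
    have hN := memLp_particleCount (μ := μ) hy hV
    have hvar := variance_particleCount_le hy hind hV fun j => (hq j).le
    rw [variance_eq_integral hN.1.aemeasurable, hmean] at hvar
    have hpt : ∀ ω, ((p : ℝ) - ((min (particleCount (fun j => y j ω) V) p : ℕ) : ℝ)) ^ 2 ≤
        4 * p ^ 2 / lam ^ 2 * ((particleCount (fun j => y j ω) V : ℝ) - lam) ^ 2 := by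
      intro ω
      rcases le_or_gt p (particleCount (fun j => y j ω) V) with h | h
      · rw [min_eq_right h, sub_self, zero_pow two_ne_zero]
        positivity
      · have hNp : (particleCount (fun j => y j ω) V : ℝ) < p := by exact_mod_cast h
        have h1 : lam / 2 ≤ lam - (particleCount (fun j => y j ω) V : ℝ) := by linarith
        have h2 : (lam / 2) ^ 2 ≤ ((particleCount (fun j => y j ω) V : ℝ) - lam) ^ 2 := by
          rw [← neg_sq ((particleCount (fun j => y j ω) V : ℝ) - lam), neg_sub]
          exact pow_le_pow_left₀ (by positivity) h1 2
        calc _ ≤ (p : ℝ) ^ 2 := pow_le_pow_left₀ (hbound ω).1 (hbound ω).2 2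
          _ = 4 * p ^ 2 / lam ^ 2 * (lam / 2) ^ 2 := by field_simp; ring
          _ ≤ _ := by gcongr
    have hint : Integrable (fun ω => 4 * p ^ 2 / lam ^ 2 *
        ((particleCount (fun j => y j ω) V : ℝ) - lam) ^ 2) μ :=
      (hN.sub (memLp_const lam)).integrable_sq.const_mul _
    calc _ ≤ ∫ ω, 4 * p ^ 2 / lam ^ 2 * ((particleCount (fun j => y j ω) V : ℝ) - lam) ^ 2 ∂μ :=
          integral_mono hdiff.integrable_sq hint hpt
      _ ≤ 4 * p ^ 2 / lam ^ 2 * lam := by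
          rw [integral_const_mul]
          gcongr
      _ = 4 * p ^ 2 / lam := by field_simp
      _ ≤ _ := by
          gcongr
          norm_num
  · calc _ ≤ ∫ _, (p : ℝ) ^ 2 ∂μ :=
          integral_mono hdiff.integrable_sq (integrable_const _)
            fun ω => pow_le_pow_left₀ (hbound ω).1 (hbound ω).2 2
      _ = (p : ℝ) ^ 2 := by simp
      _ ≤ _ := by
          rw [le_div_iff₀ hnq]
          calc (p : ℝ) ^ 2 * lam ≤ (p : ℝ) ^ 2 * (2 * p) := by gcongr
            _ = 2 * (p : ℝ) ^ 3 := by ring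
            _ ≤ 4 * (p : ℝ) ^ 4 := by
              have : (p : ℝ) ^ 3 ≤ p ^ 4 := pow_le_pow_right₀ hp1 (by norm_num)
              have h0 : (0 : ℝ) ≤ p ^ 3 := by positivity
              linarith

end Counts

/-! ### Variance of the rank -/

lemma sum_pow_sub_le {r : ℝ} (h0 : 0 ≤ r) (h1 : r < 1) (κ : ℕ) :
    ∑ k ∈ Finset.Icc 1 κ, r ^ (κ - k) ≤ (1 - r)⁻¹ := by
  have h2 : 0 < 1 - r := by linarith
  induction κ with
  | zero => simpa using h2.le
  | succ κ ih =>
    rw [Finset.sum_Icc_succ_top (by omega), Nat.sub_self, pow_zero]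
    have : ∑ k ∈ Finset.Icc 1 κ, r ^ (κ + 1 - k) = r * ∑ k ∈ Finset.Icc 1 κ, r ^ (κ - k) := by
      rw [Finset.mul_sum]
      refine Finset.sum_congr rfl fun k hk => ?_
      rw [Nat.succ_sub (Finset.mem_Icc.1 hk).2, pow_succ']
    rw [this]
    calc _ ≤ r * (1 - r)⁻¹ + 1 := by gcongr
      _ = _ := by field_simp; ring

lemma variance_rankR_le {d : ℕ} (hd : 0 < d) {a : Fin d → ℝ} {L : ℝ} (hL : 0 < L)
    (σ : Fin d → SignType) {p : ℕ} (hp : 1 ≤ p) {Ω : Type*} [MeasurableSpace Ω] {μ : Measure Ω}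
    [IsProbabilityMeasure μ] {n : ℕ} (hn : n ≠ 0) {y : Fin n → Ω → Fin d → ℝ}
    (hy : ∀ j, Measurable (y j)) (hind : iIndepFun y μ)
    (hu : ∀ j, pdf.IsUniform (y j) (hypercube a L) μ volume) :
    Var[fun ω => (rankR a L σ p (fun j => y j ω) : ℝ); μ] ≤
      ((2 ^ d * (2 * p ^ 2) * (1 - √(1 / 2))⁻¹ + 2 ^ d) *
        2 ^ ((Finset.univ.filter fun i => σ i = 0).card * depth d n)) ^ 2 := by
  set e := (Finset.univ.filter fun i => σ i = 0).card with he
  set κ := depth d n with hκ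
  set r : ℝ := √(1 / 2) with hr
  have hr0 : 0 < r := by positivity
  have hr2 : r ^ 2 = 1 / 2 := Real.sq_sqrt (by norm_num)
  have hr1 : r < 1 := by nlinarith
  have h1r : 0 < 1 - r := by linarith
  have hb : 1 < 2 ^ d := Nat.one_lt_two_pow hd.ne'
  have hp0 : (0 : ℝ) < p := by exact_mod_cast hp
  have hnlow : (2 : ℝ) ^ (d * κ) ≤ n := by
    have := Nat.pow_log_le_self (2 ^ d) hn
    rw [← pow_mul] at this
    exact_mod_cast this
  have hnup : (n : ℝ) ≤ 2 ^ d * 2 ^ (d * κ) := by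
    have := (Nat.lt_pow_succ_log_self hb n).le
    rw [← pow_mul, Nat.succ_eq_add_one, mul_add, mul_one, add_comm, pow_add] at this
    exact_mod_cast this
  have hn0 : (0 : ℝ) < n := by exact_mod_cast Nat.pos_of_ne_zero hn
  have hterm : ∀ k ∈ Finset.Icc 1 κ, ∀ m ∈ farIndices σ k,
      Var[fun ω => ((min (particleCount (fun j => y j ω) (cell a L k m)) p : ℕ) : ℝ); μ] ≤
        (2 * p ^ 2 * r ^ (κ - k)) ^ 2 := by
    intro k hk m hm
    refine (variance_min_particleCount_le hy hind (measurableSet_cell a L k m)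
      (fun j => measureReal_preimage_cell hL (hy j) (hu j) (Finset.mem_filter.1 hm).1)
      (by positivity) hp).trans ?_
    have hsq : (2 * (p : ℝ) ^ 2 * r ^ (κ - k)) ^ 2 = 4 * p ^ 4 * (1 / 2) ^ (κ - k) := by
      rw [mul_pow, ← pow_mul, mul_comm (κ - k), pow_mul, hr2]
      ring
    rw [hsq, div_eq_mul_inv]
    gcongr
    rw [one_div, inv_pow]
    gcongr
    rw [← div_eq_mul_inv, le_div_iff₀ (by positivity)]
    refine le_trans ?_ hnlow
    rw [← pow_add]
    refine pow_le_pow_right₀ (by norm_num) ?_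
    -- The decay `2 ^ (-d * (κ - k))` is weakened to `2 ^ (-(κ - k))`, so that the ratio `r` does
    -- not depend on `d`.
    have hkκ := (Finset.mem_Icc.1 hk).2
    calc κ - k + d * k ≤ d * (κ - k) + d * k := by
          gcongr
          exact Nat.le_mul_of_pos_left _ hd
      _ = d * κ := by rw [← mul_add, Nat.sub_add_cancel hkκ]
  have hlevel : ∀ k ∈ Finset.Icc 1 κ,
      Var[fun ω => ∑ m ∈ farIndices σ k,
        ((min (particleCount (fun j => y j ω) (cell a L k m)) p : ℕ) : ℝ); μ] ≤
        (2 ^ d * 2 ^ (e * κ) * (2 * p ^ 2 * r ^ (κ - k))) ^ 2 := by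
    intro k hk
    refine (variance_sum_le_sq (fun m _ => memLp_min_particleCount hy (measurableSet_cell a L k m) p)
      (fun m _ => by positivity) (hterm k hk)).trans ?_
    rw [Finset.sum_const, nsmul_eq_mul]
    gcongr
    -- Bounding the number of cells by its value at depth `κ` leaves a pure geometric series in `r`,
    -- also when `e = 0`.
    calc ((farIndices σ k).card : ℝ) ≤ 2 ^ d * 2 ^ (e * k) := by
          exact_mod_cast card_farIndices_le σ k
      _ ≤ _ := by
          gcongr
          · norm_num
          · exact (Finset.mem_Icc.1 hk).2
  have hfarLp : ∀ k, MemLp (fun ω => ∑ m ∈ farIndices σ k,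
      ((min (particleCount (fun j => y j ω) (cell a L k m)) p : ℕ) : ℝ)) 2 μ := fun k =>
    memLp_finsetSum _ fun m _ => memLp_min_particleCount hy (measurableSet_cell a L k m) p
  have hnear : Var[fun ω => (particleCount (fun j => y j ω) (nearRegion a L σ κ) : ℝ); μ] ≤
      (2 ^ d * 2 ^ (e * κ)) ^ 2 := by
    refine (variance_particleCount_le hy hind (measurableSet_nearRegion a L σ κ)
      fun j => measureReal_preimage_nearRegion_le hL σ (hy j) (hu j) κ).trans ?_
    calc (n : ℝ) * (2 ^ (e * κ) * (2 ^ (d * κ))⁻¹)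
        ≤ 2 ^ d * 2 ^ (d * κ) * (2 ^ (e * κ) * (2 ^ (d * κ))⁻¹) := by gcongr
      _ = 2 ^ d * 2 ^ (e * κ) := by field_simp
      -- The near variance is only of first order in `2 ^ (e * κ)`; it is squared to match the far
      -- part.
      _ ≤ _ := le_self_pow₀ (one_le_mul_of_one_le_of_one_le (one_le_pow₀ (by norm_num))
          (one_le_pow₀ (by norm_num))) two_ne_zero
  have hfar := variance_sum_le_sq (fun k _ => hfarLp k) (fun k _ => by positivity) hlevel
  rw [← Finset.mul_sum, ← Finset.mul_sum] at hfar
  have hfar' : Var[fun ω => ∑ k ∈ Finset.Icc 1 κ, ∑ m ∈ farIndices σ k,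
      ((min (particleCount (fun j => y j ω) (cell a L k m)) p : ℕ) : ℝ); μ] ≤
      (2 ^ d * 2 ^ (e * κ) * (2 * p ^ 2 * (1 - r)⁻¹)) ^ 2 := by
    refine hfar.trans ?_
    have := sum_pow_sub_le hr0.le hr1 κ
    gcongr
  have := variance_add_le_sq (memLp_finsetSum _ fun k _ => hfarLp k)
    (memLp_particleCount hy (measurableSet_nearRegion a L σ κ)) (by positivity) (by positivity)
    hfar' hnear
  simp only [rankR, Nat.cast_add, Nat.cast_sum]
  refine this.trans_eq ?_
  ring

lemma two_pow_mul_depth_le {d d' n : ℕ} (hd : 0 < d) (hn : n ≠ 0) :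
    (2 : ℝ) ^ (d' * depth d n) ≤ (n : ℝ) ^ ((d' : ℝ) / d) := by
  have hnlow : (2 : ℝ) ^ (d * depth d n) ≤ n := by
    have := Nat.pow_log_le_self (2 ^ d) hn
    rw [← pow_mul] at this
    exact_mod_cast this
  have hd0 : (d : ℝ) ≠ 0 := by exact_mod_cast hd.ne'
  calc (2 : ℝ) ^ (d' * depth d n) = ((2 : ℝ) ^ (d * depth d n)) ^ ((d' : ℝ) / d) := by
        rw [← Real.rpow_natCast, ← Real.rpow_natCast, ← Real.rpow_mul (by norm_num)]
        congr 1
        push_cast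
        field_simp
    _ ≤ _ := by gcongr

lemma eventually_one_le_log_log_log :
    ∀ᶠ n : ℕ in atTop, (1 : ℝ) ≤ Real.log (Real.log (Real.log n)) :=
  (Real.tendsto_log_atTop.comp (Real.tendsto_log_atTop.comp
    (Real.tendsto_log_atTop.comp tendsto_natCast_atTop_atTop))).eventually_ge_atTop 1

theorem mainTheorem2 {𝕜 : Type*} [RCLike 𝕜] (d d' : ℕ) (hd : d' < d)
    (a : Fin d → ℝ) (L : ℝ) (hL : 0 < L) (σ : Fin d → SignType)
    (hσ : (Finset.univ.filter fun i => σ i = 0).card = d')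
    (K : (Fin d → ℝ) → (Fin d → ℝ) → 𝕜) (hKm : Measurable (Function.uncurry K))
    (hK : FarFieldAnalytic K (hypercube (targetCorner a L σ) L) (hypercube a L))
    (δ : ℝ) (hδ : 0 < δ) :
    ∃ p : ℕ, ∀ (Ω : Type*) [MeasurableSpace Ω] (μ : Measure Ω) [IsProbabilityMeasure μ]
      (x y : ∀ n : ℕ, Fin n → Ω → Fin d → ℝ),
      (∀ n i, Measurable (x n i)) → (∀ n i, Measurable (y n i)) →
      (∀ n, iIndepFun (x n) μ) → (∀ n, iIndepFun (y n) μ) →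
      (∀ n i, pdf.IsUniform (x n i) (hypercube (targetCorner a L σ) L) μ volume) →
      (∀ n i, pdf.IsUniform (y n i) (hypercube a L) μ volume) →
      (∀ n : ℕ, ∃ (Kfar : Ω → ℕ → (Fin d → ℕ) → Matrix (Fin n) (Fin n) 𝕜)
          (Knear : Ω → Matrix (Fin n) (Fin n) 𝕜),
        (∀ k m i j, Measurable fun ω => Kfar ω k m i j) ∧
        (∀ i j, Measurable fun ω => Knear ω i j) ∧
        ∀ᵐ ω ∂μ, IsHierarchicalApprox K a L σ δ p
          (fun i => x n i ω) (fun j => y n j ω) (Kfar ω) (Knear ω)) ∧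
      (d' = 0 →
        (fun n : ℕ => variance (fun ω => (rankR a L σ p (fun j => y n j ω) : ℝ)) μ)
          =O[atTop] fun n : ℕ => Real.log (Real.log (Real.log n)) ^ 2) ∧
      (1 ≤ d' →
        (fun n : ℕ => variance (fun ω => (rankR a L σ p (fun j => y n j ω) : ℝ)) μ)
          =O[atTop] fun n : ℕ =>
            ((n : ℝ) ^ ((d' : ℝ) / d) * Real.log (Real.log (Real.log n))) ^ 2) := by
  have hd0 : 0 < d := by omega
  obtain ⟨t, D, hfar⟩ := exists_far_approx hL hK (by positivity : 0 < δ / 4)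
  -- The rank bound is the number of basis functions, `2 ^ (t * d) * (D + 1) ^ d`. It is fixed
  -- before `n` and the probability space.
  refine ⟨Fintype.card (FarBasisIndex d t D), ?_⟩
  intro Ω _ μ _ x y hx hy _ hindy hux huy
  have hvar : ∃ A : ℝ, 0 ≤ A ∧ ∀ n : ℕ, n ≠ 0 →
      variance (fun ω => (rankR a L σ (Fintype.card (FarBasisIndex d t D))
        (fun j => y n j ω) : ℝ)) μ ≤ (A * (n : ℝ) ^ ((d' : ℝ) / d)) ^ 2 := by
    have h1r : 0 ≤ (1 - √(1 / 2 : ℝ))⁻¹ :=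
      inv_nonneg.2 (sub_nonneg.2 (Real.sqrt_le_one.2 (by norm_num)))
    have hA : (0 : ℝ) ≤ 2 ^ d * (2 * (Fintype.card (FarBasisIndex d t D) : ℝ) ^ 2) *
        (1 - √(1 / 2 : ℝ))⁻¹ + 2 ^ d :=
      add_nonneg (mul_nonneg (by positivity) h1r) (by positivity)
    refine ⟨_, hA, fun n hn => (variance_rankR_le hd0 hL σ Fintype.card_pos hn (hy n)
      (hindy n) (huy n)).trans ?_⟩
    rw [hσ]
    gcongr
    exact two_pow_mul_depth_le hd0 hn
  obtain ⟨A, hA, hvar⟩ := hvar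
  have hO : (fun n : ℕ => variance (fun ω => (rankR a L σ (Fintype.card (FarBasisIndex d t D))
      (fun j => y n j ω) : ℝ)) μ) =O[atTop]
        fun n : ℕ => ((n : ℝ) ^ ((d' : ℝ) / d) * Real.log (Real.log (Real.log n))) ^ 2 := by
    refine IsBigO.of_bound (A ^ 2) ?_
    filter_upwards [eventually_one_le_log_log_log, eventually_ne_atTop 0] with n hlog hn
    rw [Real.norm_of_nonneg (variance_nonneg _ _), Real.norm_of_nonneg (sq_nonneg _), ← mul_pow]
    refine (hvar n hn).trans ?_
    gcongr
    exact le_mul_of_one_le_right (by positivity) hlog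
  refine ⟨fun n => exists_measurable_hierarchicalApprox hL σ hKm hδ hfar (hx n) (hy n) (hux n)
    (huy n), fun h0 => ?_, fun _ => hO⟩
  simpa [h0] using hO
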